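/- **Notation.** For $a\in\mathbb R$ and $\theta\in(\pi/2,\pi)$ let $\Sigma(a;\theta)=\{a+re^{i\varphi}: r>0,\ \varphi\in(-\pi,\pi],\ |\varphi|\ge\theta\}$ and $\Sigma^c(a;\theta)=\mathbb C\setminus\Sigma(a;\theta)$ (so $a\in\Sigma^c(a;\theta)$). $\rho(T)$ is the resolvent set, $\sigma(T)$ the spectrum, and $R(\mu,T)=(\mu I-T)^{-1}$. **Setting.** Let $H,U$ be complex Hilbert spaces, $A:D(A)\subset H\to H$ linear, $B\in\mathcal L(U,H)$, $\hat\nu,\omega\in\mathbb R$, $\theta_0\in(\pi/2,\pi)$. For each $h>0$ let $H_h\subset H$ be a finite-dimensional subspace, $\Pi_h:H\to H_h$ the orthogonal projection, $A_h\in\mathcal L(H_h)$. Put $A_\omega=A+\omega I$, $A_{\omega_h}=A_h+\omega I$, $B_h=\Pi_hB$. "$C$ independent of $h$" is always understood for all $h>0$ in the hypotheses. (A1) There are $C_B,C_1,C>0$, independent of $h$ and $\mu$, such that: (a) $\|B\|\le C_B$ and $\|B_h\|\le C_B$; (b) $A_\omega$ generates an analytic semigroup on $H$, $\Sigma^c(-\hat\nu+\omega;\theta_0)\subset\rho(A_\omega)$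 and $\|R(\mu,A_\omega)\|\le C_1/|\mu+\hat\nu-\omega|$ for all $\mu\in\Sigma^c(-\hat\nu+\omega;\theta_0)$, $\mu\ne-\hat\nu+\omega$; (c) for all $h>0$ the same inclusion and estimate, with the same $C_1$, hold for $A_{\omega_h}$ on $H_h$; (d) $\|R(\mu,A_\omega)-R(\mu,A_{\omega_h})\Pi_h\|_{\mathcal L(H)}\le Ch^2$ for all $\mu\in\Sigma^c(-\hat\nu+\omega;\theta_0)$ and $h>0$. (A3) $F_h\in\mathcal L(H_h,U)$ and $\|F_h\|\le C_3$, with $C_3$ independent of $h$. (A4) $F\in\mathcal L(H,U)$ and $\|F-F_h\|_{\mathcal L(H_h,U)}\le Ch^s$ for some $s\in(0,2]$ and $C>0$ independent of $h$. (A5) $A_{\omega,F}:=A_\omega+BF$ (with domain $D(A)$) generates a strongly continuous semigroup with $\|e^{tA_{\omega,F}}\|\le Ce^{-\gamma t}$ for all $t>0$, for some $C,\gamma>0$; moreover $\operatorname{Re}\Lambda\le-\gamma$ for all $\Lambda\in\sigma(A_{\omega,F})$, and $\Sigma^c(-\gamma;\theta_P)\subset\rho(A_{\omega,F})$ for some $\theta_P\in(\pi/2,\pi)$.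 **Theorem (exponential stability).** Assume (A1), (A3), (A4), (A5), let $A_{\omega_h,F_h}:=A_{\omega_h}+B_hF_h$ and fix $\phi_0$ with $\pi/2<\phi_0<\min\{\theta_0,\theta_P\}$. Then for every $\hat\gamma\in(0,\gamma)$ there are $h_{\hat\gamma}>0$ and $C>0$ independent of $h$ such that for all $0<h<h_{\hat\gamma}$: (a) $\Sigma^c(-\hat\gamma;\phi_0)\subset\rho(A_{\omega_h,F_h})$ and $\|R(\mu,A_{\omega_h,F_h})\|_{\mathcal L(H_h)}\le\dfrac{C}{|\mu+\hat\gamma|}$ for all $\mu\in\Sigma^c(-\hat\gamma;\phi_0)$, $\mu\ne-\hat\gamma$; (b) $\|e^{tA_{\omega_h,F_h}}\|_{\mathcal L(H_h)}\le Ce^{-\hat\gamma t}$ for all $t>0$. **Application to the coupled parabolic system.** In particular, let $\Omega\subset\mathbb R^n$ and $\mathcal O\subset\mathbb R^n$ be open, $H=L^2(\Omega)\times L^2(\Omega)$, $U=L^2(\Omega)$ (complex valued), $\eta_0,\beta_0,\kappa,\omega>0$, $\eta_1,\nu_0\in\mathbb R$ with $\hat\nu:=\nu_0-\frac{|\eta_1|+1}{2}>0$,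 $$A\begin{pmatrix}y\\z\end{pmatrix}=\begin{pmatrix}\eta_0\Delta y-\nu_0y-\eta_1z\\ y+\beta_0\Delta z-(\kappa+\nu_0)z\end{pmatrix},\quad D(A)=(H^2(\Omega)\cap H^1_0(\Omega))^2,\quad Bf=\begin{pmatrix}f\chi_{\mathcal O}\\0\end{pmatrix},$$ let $V_h\subset H^1_0(\Omega)$ be finite-dimensional, $H_h=V_h\times V_h$, and let $A_h$ be defined by $\langle-A_hY,\Phi\rangle=a(Y,\Phi)$ for $Y,\Phi\in H_h$, where, for $Y=(y,z)$ and $\Phi=(\phi,\psi)$, $a(Y,\Phi)=\eta_0\langle\nabla y,\nabla\phi\rangle+\eta_1\langle z,\phi\rangle+\nu_0\langle y,\phi\rangle+\beta_0\langle\nabla z,\nabla\psi\rangle+(\kappa+\nu_0)\langle z,\psi\rangle-\langle y,\psi\rangle$. If (A1) and (A3)–(A5) hold for these objects, then (a) and (b) hold for all $\hat\gamma\in(0,\gamma)$ as above. -/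

import Mathlib

open MeasureTheory Filter Topology TopologicalSpace
open scoped InnerProductSpace Distributions

noncomputable section

/-! ### Sectors, resolvents and semigroups -/

/-- The sector `Σ(a; θ) = {a + r e^{iφ} : r > 0, φ ∈ (-π, π], |φ| ≥ θ}`.
The apex `a` belongs to its complement. -/
def sector (a θ : ℝ) : Set ℂ :=
  {z | ∃ r φ : ℝ, 0 < r ∧ φ ∈ Set.Ioc (-Real.pi) Real.pi ∧ θ ≤ |φ| ∧
    z = a + r * Complex.exp (φ * Complex.I)}

section Operators

variable {H : Type*} [NormedAddCommGroup H] [InnerProductSpace ℂ H]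

/-- `R` is a bounded two-sided inverse of `μ I - A : D(A) → H`. -/
def IsResolventAt (A : H →ₗ.[ℂ] H) (μ : ℂ) (R : H →L[ℂ] H) : Prop :=
  (∀ x : H, ∃ hx : R x ∈ A.domain, μ • R x - A ⟨R x, hx⟩ = x) ∧
  ∀ x : A.domain, R (μ • (x : H) - A x) = x

/-- The resolvent set `ρ(A)` of an unbounded operator. -/
def rho (A : H →ₗ.[ℂ] H) : Set ℂ := {μ | ∃ R : H →L[ℂ] H, IsResolventAt A μ R}

open scoped Classical in
/-- The resolvent operator `R(μ, A) = (μ I - A)⁻¹` for `μ ∈ ρ(A)`. -/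
def resolventOp (A : H →ₗ.[ℂ] H) (μ : ℂ) : H →L[ℂ] H :=
  if h : μ ∈ rho A then h.choose else 0

/-- `A + T` with domain `D(A)`, for a bounded operator `T`. -/
def addBounded (A : H →ₗ.[ℂ] H) (T : H →L[ℂ] H) : H →ₗ.[ℂ] H := (T : H →ₗ[ℂ] H) +ᵥ A

/-- `A_ω = A + ω I`, with `D(A_ω) = D(A)`. -/
def shift (A : H →ₗ.[ℂ] H) (ω : ℝ) : H →ₗ.[ℂ] H :=
  addBounded A ((ω : ℂ) • ContinuousLinearMap.id ℂ H)

/-- A strongly continuous semigroup of bounded operators; only times `t ≥ 0` matter. -/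
structure IsC0Semigroup (S : ℝ → H →L[ℂ] H) : Prop where
  zero : S 0 = ContinuousLinearMap.id ℂ H
  add : ∀ s t : ℝ, 0 ≤ s → 0 ≤ t → S (s + t) = (S s).comp (S t)
  tendsto : ∀ x : H, Tendsto (fun t : ℝ => S t x) (𝓝[>] 0) (𝓝 x)

/-- `S` is a strongly continuous semigroup whose infinitesimal generator is exactly `A`. -/
def Generates (A : H →ₗ.[ℂ] H) (S : ℝ → H →L[ℂ] H) : Prop :=
  IsC0Semigroup S ∧
  ∀ x y : H, (x, y) ∈ A.graph ↔
    Tendsto (fun t : ℝ => ((t : ℂ)⁻¹) • (S t x - x)) (𝓝[>] 0) (𝓝 y)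

/-- `A` generates an analytic semigroup: it generates a strongly continuous semigroup and satisfies
a resolvent estimate off some sector. -/
def GeneratesAnalyticSemigroup (A : H →ₗ.[ℂ] H) : Prop :=
  (∃ S, Generates A S) ∧
  ∃ a θ C : ℝ, Real.pi / 2 < θ ∧ θ < Real.pi ∧ 0 < C ∧ (sector a θ)ᶜ ⊆ rho A ∧
    ∀ μ ∈ (sector a θ)ᶜ, μ ≠ a → ‖resolventOp A μ‖ ≤ C / ‖μ - a‖

end Operators

/-- `e^{tT}` for a bounded operator `T`. -/
def expOp {E : Type*} [NormedAddCommGroup E] [NormedSpace ℂ E] (T : E →L[ℂ] E) (t : ℝ) : E →L[ℂ] E :=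
  NormedSpace.exp ((t : ℂ) • T)

/-! ### The approximation framework

`H`, `U` are the state and control spaces, `Hh h` (`h > 0`) are finite dimensional subspaces of
`H` and `Π_h` is the orthogonal projection of `H` onto `Hh h`. -/

section Framework

variable {H U : Type*} [NormedAddCommGroup H] [InnerProductSpace ℂ H] [CompleteSpace H]
  [NormedAddCommGroup U] [InnerProductSpace ℂ U] [CompleteSpace U]

/-- `Π_h` as a map `H → H_h`. -/
def Pih (Hh : ℝ → Submodule ℂ H) [∀ h, FiniteDimensional ℂ (Hh h)] (h : ℝ) : H →L[ℂ] Hh h :=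
  (Hh h).orthogonalProjectionOnto

/-- `B_h = Π_h B`. -/
def discreteControl (Hh : ℝ → Submodule ℂ H) [∀ h, FiniteDimensional ℂ (Hh h)]
    (B : U →L[ℂ] H) (h : ℝ) : U →L[ℂ] Hh h :=
  (Pih Hh h).comp B

/-- `A_{ω_h} = A_h + ω I_h`. -/
def discreteShift {Hh : ℝ → Submodule ℂ H} (Ah : ∀ h, Hh h →L[ℂ] Hh h) (ω : ℝ) (h : ℝ) :
    Hh h →L[ℂ] Hh h :=
  Ah h + (ω : ℂ) • ContinuousLinearMap.id ℂ (Hh h)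

/-- `A_{ω_h, F_h} = A_{ω_h} + B_h F_h`. -/
def discreteClosedLoop {Hh : ℝ → Submodule ℂ H} [∀ h, FiniteDimensional ℂ (Hh h)]
    (Ah : ∀ h, Hh h →L[ℂ] Hh h) (ω : ℝ) (B : U →L[ℂ] H) (Fh : ∀ h, Hh h →L[ℂ] U) (h : ℝ) :
    Hh h →L[ℂ] Hh h :=
  discreteShift Ah ω h + (discreteControl Hh B h).comp (Fh h)

/-- The standing properties of the operators, with sector apex `-ν̂ + ω` and angle `θ₀`:
bounds for `B` and `B_h`; `A_ω` generates an analytic semigroup, with a resolvent estimate off the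
sector; the same resolvent estimate for all `A_{ω_h}`, uniformly in `h`; and
`‖R(μ, A_ω) - R(μ, A_{ω_h}) Π_h‖ ≤ C h²` uniformly off the sector. -/
def SemigroupApproximation (A : H →ₗ.[ℂ] H) (B : U →L[ℂ] H)
    (Hh : ℝ → Submodule ℂ H) [∀ h, FiniteDimensional ℂ (Hh h)]
    (Ah : ∀ h, Hh h →L[ℂ] Hh h) (νhat ω θ₀ : ℝ) : Prop :=
  (∃ CB : ℝ, 0 < CB ∧ ‖B‖ ≤ CB ∧ ∀ h, 0 < h → ‖discreteControl Hh B h‖ ≤ CB) ∧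
  ∃ C₁ : ℝ, 0 < C₁ ∧
  (GeneratesAnalyticSemigroup (shift A ω) ∧ (sector (-νhat + ω) θ₀)ᶜ ⊆ rho (shift A ω) ∧
    ∀ μ ∈ (sector (-νhat + ω) θ₀)ᶜ, μ ≠ -νhat + ω →
      ‖resolventOp (shift A ω) μ‖ ≤ C₁ / ‖μ + νhat - ω‖) ∧
  (∀ h, 0 < h → (sector (-νhat + ω) θ₀)ᶜ ⊆ resolventSet ℂ (discreteShift Ah ω h) ∧
    ∀ μ ∈ (sector (-νhat + ω) θ₀)ᶜ, μ ≠ -νhat + ω →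
      ‖resolvent (discreteShift Ah ω h) μ‖ ≤ C₁ / ‖μ + νhat - ω‖) ∧
  ∃ C : ℝ, 0 < C ∧ ∀ h, 0 < h → ∀ μ ∈ (sector (-νhat + ω) θ₀)ᶜ,
    ‖resolventOp (shift A ω) μ -
      (Hh h).subtypeL.comp ((resolvent (discreteShift Ah ω h) μ).comp (Pih Hh h))‖ ≤ C * h ^ 2

/-- The `F_h` are uniformly bounded. -/
def UniformlyBoundedFeedback {Hh : ℝ → Submodule ℂ H} (Fh : ∀ h, Hh h →L[ℂ] U) : Prop :=
  ∃ C₃ : ℝ, 0 < C₃ ∧ ∀ h, 0 < h → ‖Fh h‖ ≤ C₃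

/-- `‖F - F_h‖ ≤ C h^s` on `H_h`, for some `s ∈ (0, 2]`. -/
def FeedbackConvergence {Hh : ℝ → Submodule ℂ H} (F : H →L[ℂ] U) (Fh : ∀ h, Hh h →L[ℂ] U) : Prop :=
  ∃ s C : ℝ, 0 < s ∧ s ≤ 2 ∧ 0 < C ∧
    ∀ h, 0 < h → ‖F.comp (Hh h).subtypeL - Fh h‖ ≤ C * h ^ s

/-- `A_ω + B F` is exponentially stable with decay `-γ`, its spectrum lies in
`Re ≤ -γ`, and its resolvent set contains `Σᶜ(-γ; θ_P)`. -/
def StabilizingFeedback (A : H →ₗ.[ℂ] H) (ω : ℝ) (B : U →L[ℂ] H) (F : H →L[ℂ] U) (γ θP : ℝ) : Prop :=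
  (∃ S, Generates (addBounded (shift A ω) (B.comp F)) S ∧
    ∃ C : ℝ, 0 < C ∧ ∀ t : ℝ, 0 < t → ‖S t‖ ≤ C * Real.exp (-γ * t)) ∧
  (∀ z ∈ (rho (addBounded (shift A ω) (B.comp F)))ᶜ, z.re ≤ -γ) ∧
  (sector (-γ) θP)ᶜ ⊆ rho (addBounded (shift A ω) (B.comp F))

/-- The conclusion for a family of discrete operators `T_h` on `H_h`: below a threshold in `h`, and
with one constant `C` for all such `h`, sectorial resolvent estimates with apex `-g` and
exponential decay `-g` of the semigroups. -/
def UniformlyExpStable {Hh : ℝ → Submodule ℂ H} (T : ∀ h, Hh h →L[ℂ] Hh h) (φ₀ g : ℝ) : Prop :=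
  ∃ hg C : ℝ, 0 < hg ∧ 0 < C ∧ ∀ h, 0 < h → h < hg →
    ((sector (-g) φ₀)ᶜ ⊆ resolventSet ℂ (T h) ∧
      ∀ μ ∈ (sector (-g) φ₀)ᶜ, μ ≠ -g → ‖resolvent (T h) μ‖ ≤ C / ‖μ + g‖) ∧
    ∀ t : ℝ, 0 < t → ‖expOp (T h) t‖ ≤ C * Real.exp (-g * t)

end Framework

/-! ### The coupled parabolic system and its conforming Galerkin approximation -/

section Parabolic

variable {n : ℕ}

/-- Complex `L²(Ω)`. -/
abbrev L2 (Ω : Opens (EuclideanSpace ℝ (Fin n))) : Type :=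
  Lp ℂ 2 (volume.restrict (Ω : Set (EuclideanSpace ℝ (Fin n))))

/-- `L²(Ω)ⁿ` with its Hilbert norm. -/
abbrev L2Vec (Ω : Opens (EuclideanSpace ℝ (Fin n))) : Type := PiLp 2 (fun _ : Fin n => L2 Ω)

/-- The state space `L²(Ω) × L²(Ω)` with its Hilbert norm. -/
abbrev StateSpace (Ω : Opens (EuclideanSpace ℝ (Fin n))) : Type := WithLp 2 (L2 Ω × L2 Ω)

variable (Ω : Opens (EuclideanSpace ℝ (Fin n)))

/-- The partial derivative `∂ᵢ φ` of a test function. -/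
def partialDeriv (i : Fin n) (φ : 𝓓(Ω, ℂ)) : EuclideanSpace ℝ (Fin n) → ℂ :=
  fun x => fderiv ℝ φ x (EuclideanSpace.single i 1)

theorem testFun_memLp (φ : 𝓓(Ω, ℂ)) :
    MemLp φ 2 (volume.restrict (Ω : Set (EuclideanSpace ℝ (Fin n)))) :=
  φ.continuous.memLp_of_hasCompactSupport φ.hasCompactSupport

theorem partialDeriv_memLp (i : Fin n) (φ : 𝓓(Ω, ℂ)) :
    MemLp (partialDeriv Ω i φ) 2 (volume.restrict (Ω : Set (EuclideanSpace ℝ (Fin n)))) := by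
  have hc : Continuous (partialDeriv Ω i φ) :=
    (φ.contDiff.continuous_fderiv (by simp)).clm_apply continuous_const
  exact hc.memLp_of_hasCompactSupport (φ.hasCompactSupport.fderiv_apply (𝕜 := ℝ) _)

/-- A test function as an element of `L²(Ω)`. -/
def testL2 (φ : 𝓓(Ω, ℂ)) : L2 Ω := (testFun_memLp Ω φ).toLp

/-- `∂ᵢ φ` as an element of `L²(Ω)`. -/
def dTestL2 (i : Fin n) (φ : 𝓓(Ω, ℂ)) : L2 Ω := (partialDeriv_memLp Ω i φ).toLp

/-- `v = ∂ᵢ u` weakly in `Ω`: `∫ v φ̄ = - ∫ u ∂ᵢφ̄` for every test function `φ`. -/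
def IsWeakDeriv (i : Fin n) (u v : L2 Ω) : Prop :=
  ∀ φ : 𝓓(Ω, ℂ), ⟪testL2 Ω φ, v⟫_ℂ = -⟪dTestL2 Ω i φ, u⟫_ℂ

/-- The graph of the gradient on `H¹₀(Ω)`: the closure in `L²(Ω) × L²(Ω)ⁿ` of the
pairs `(φ, ∇φ)`, `φ` a test function. -/
def gradGraph : Submodule ℂ (L2 Ω × L2Vec Ω) :=
  (Submodule.span ℂ (Set.range fun φ : 𝓓(Ω, ℂ) =>
    ((testL2 Ω φ, WithLp.toLp 2 (fun i => dTestL2 Ω i φ)) : L2 Ω × L2Vec Ω))).topologicalClosure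

theorem eq_zero_of_forall_inner_testL2 (v : L2 Ω)
    (hv : ∀ φ : 𝓓(Ω, ℂ), ⟪testL2 Ω φ, v⟫_ℂ = 0) : v = 0 := by
  have hloc : LocallyIntegrableOn v (Ω : Set (EuclideanSpace ℝ (Fin n))) volume :=
    locallyIntegrableOn_of_locallyIntegrable_restrict
      ((Lp.memLp v).locallyIntegrable (by norm_num))
  have h0 := Ω.isOpen.ae_eq_zero_of_integral_contDiff_smul_eq_zero hloc (by
    intro g hg hgc hgs
    let φ : 𝓓(Ω, ℂ) := ⟨fun x => (g x : ℂ), Complex.ofRealCLM.contDiff.comp hg,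
      hgc.comp_left (g := fun r : ℝ => (r : ℂ)) (by simp),
      (tsupport_comp_subset (g := fun r : ℝ => (r : ℂ)) (by simp) g).trans hgs⟩
    have h2 := hv φ
    rw [L2.inner_def] at h2
    rw [← setIntegral_eq_integral_of_forall_compl_eq_zero (s := (Ω : Set _))
      (fun x hx => by rw [image_eq_zero_of_notMem_tsupport (fun h => hx (hgs h)), zero_smul]), ← h2]
    refine integral_congr_ae ?_
    filter_upwards [(testFun_memLp Ω φ).coeFn_toLp] with x hx
    rw [testL2, hx, RCLike.inner_apply]
    change g x • v x = v x * (starRingEnd ℂ) (g x : ℂ)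
    rw [Complex.conj_ofReal, Complex.real_smul, mul_comm])
  rw [Lp.eq_zero_iff_ae_eq_zero]
  exact (ae_restrict_iff' Ω.isOpen.measurableSet).2 h0

theorem inner_testL2_dTestL2 (i : Fin n) (φ ψ : 𝓓(Ω, ℂ)) :
    ⟪testL2 Ω ψ, dTestL2 Ω i φ⟫_ℂ = -⟪dTestL2 Ω i ψ, testL2 Ω φ⟫_ℂ := by
  have hz : ∀ (χ : 𝓓(Ω, ℂ)) (x : EuclideanSpace ℝ (Fin n)), x ∉ Ω → χ x = 0 := fun χ x hx =>
    image_eq_zero_of_notMem_tsupport fun h => hx (χ.tsupport_subset h)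
  let S : ℂ →L[ℝ] ℂ →L[ℝ] ℂ :=
    (ContinuousLinearMap.mul ℝ ℂ).comp (Complex.conjCLE : ℂ →L[ℝ] ℂ)
  have hd : ∀ χ : 𝓓(Ω, ℂ), Continuous (partialDeriv Ω i χ) := fun χ =>
    (χ.contDiff.continuous_fderiv (by simp)).clm_apply continuous_const
  have hdiff : ∀ χ : 𝓓(Ω, ℂ), Differentiable ℝ χ := fun χ =>
    χ.contDiff.differentiable (by simp)
  have hint : ∀ f g : EuclideanSpace ℝ (Fin n) → ℂ, Continuous f → Continuous g →
      HasCompactSupport g → Integrable (fun x => S (f x) (g x)) volume := fun f g hf hg hgc =>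
    Continuous.integrable_of_hasCompactSupport (by fun_prop)
      (hgc.mono fun x hx hgx => hx (by simp [hgx]))
  have key := integral_bilinear_fderiv_right_eq_neg_left_of_integrable (μ := volume)
    (f := ψ) (g := φ) (v := EuclideanSpace.single i (1 : ℝ)) (B := S)
    (hint _ _ (hd ψ) φ.continuous φ.hasCompactSupport)
    (hint _ _ ψ.continuous (hd φ) (φ.hasCompactSupport.fderiv_apply (𝕜 := ℝ) _))
    (hint _ _ ψ.continuous φ.continuous φ.hasCompactSupport)
    (fun x _ => hdiff ψ x) (fun x _ => hdiff φ x)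
  have e1 : ⟪testL2 Ω ψ, dTestL2 Ω i φ⟫_ℂ = ∫ x, S (ψ x) (partialDeriv Ω i φ x) := by
    rw [L2.inner_def, ← setIntegral_eq_integral_of_forall_compl_eq_zero (s := (Ω : Set _))
      (f := fun x => S (ψ x) (partialDeriv Ω i φ x)) (fun x hx => by simp [hz ψ x hx])]
    refine integral_congr_ae ?_
    filter_upwards [(testFun_memLp Ω ψ).coeFn_toLp, (partialDeriv_memLp Ω i φ).coeFn_toLp]
      with x hx hx'
    rw [testL2, dTestL2, hx, hx', RCLike.inner_apply, mul_comm]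
    rfl
  have e2 : ⟪dTestL2 Ω i ψ, testL2 Ω φ⟫_ℂ = ∫ x, S (partialDeriv Ω i ψ x) (φ x) := by
    rw [L2.inner_def, ← setIntegral_eq_integral_of_forall_compl_eq_zero (s := (Ω : Set _))
      (f := fun x => S (partialDeriv Ω i ψ x) (φ x)) (fun x hx => by simp [hz φ x hx])]
    refine integral_congr_ae ?_
    filter_upwards [(testFun_memLp Ω φ).coeFn_toLp, (partialDeriv_memLp Ω i ψ).coeFn_toLp]
      with x hx hx'
    rw [testL2, dTestL2, hx, hx', RCLike.inner_apply, mul_comm]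
    rfl
  rw [e1, e2]
  exact key

/-- Functions in `H¹₀(Ω)` are weakly differentiable, and `gradGraph` holds their weak gradients. -/
theorem isWeakDeriv_of_mem_gradGraph {p : L2 Ω × L2Vec Ω} (hp : p ∈ gradGraph Ω) (i : Fin n) :
    IsWeakDeriv Ω i p.1 (p.2 i) := by
  intro φ
  have hcl : IsClosed {p : L2 Ω × L2Vec Ω | ⟪testL2 Ω φ, p.2 i⟫_ℂ = -⟪dTestL2 Ω i φ, p.1⟫_ℂ} :=
    isClosed_eq (by fun_prop) (by fun_prop)
  rw [gradGraph, ← SetLike.mem_coe, Submodule.topologicalClosure_coe] at hp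
  refine closure_minimal (s := (Submodule.span ℂ (Set.range fun φ : 𝓓(Ω, ℂ) =>
    ((testL2 Ω φ, WithLp.toLp 2 (fun i => dTestL2 Ω i φ)) : L2 Ω × L2Vec Ω)) : Set _))
    (fun q hq => ?_) hcl hp
  induction hq using Submodule.span_induction with
  | mem x h => obtain ⟨ψ, rfl⟩ := h; exact inner_testL2_dTestL2 Ω i ψ φ
  | zero => simp
  | add x y _ _ hx hy =>
    simp only [Set.mem_ofPred_eq] at hx hy ⊢
    simp [inner_add_right, hx, hy]; ring
  | smul c x _ hx =>
    simp only [Set.mem_ofPred_eq] at hx ⊢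
    simp [inner_smul_right, hx]

theorem gradGraph_single_valued (p : L2 Ω × L2Vec Ω) (hp : p ∈ gradGraph Ω) (h : p.1 = 0) :
    p.2 = 0 := by
  ext1 i
  refine eq_zero_of_forall_inner_testL2 Ω _ fun φ => ?_
  rw [isWeakDeriv_of_mem_gradGraph Ω hp i φ, h, inner_zero_right, neg_zero]

/-- The gradient on `H¹₀(Ω)`. -/
def grad : L2 Ω →ₗ.[ℂ] L2Vec Ω := (gradGraph Ω).toLinearPMap

/-- `H¹₀(Ω)` as a subspace of `L²(Ω)`. -/
def H10 : Submodule ℂ (L2 Ω) := (grad Ω).domain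

/-- The graph of the Laplacian `Δ = ∑ᵢ ∂ᵢ∂ᵢ` with domain `H²(Ω) ∩ H¹₀(Ω)`: all weak derivatives
of order one and two exist in `L²(Ω)`. -/
def laplacianGraph : Submodule ℂ (L2 Ω × L2 Ω) where
  carrier := {p | p.1 ∈ H10 Ω ∧ ∃ (v : Fin n → L2 Ω) (w : Fin n → Fin n → L2 Ω),
    (∀ i, IsWeakDeriv Ω i p.1 (v i)) ∧ (∀ i j, IsWeakDeriv Ω j (v i) (w i j)) ∧
    p.2 = ∑ i, w i i}
  zero_mem' := ⟨Submodule.zero_mem _, 0, 0, by simp [IsWeakDeriv], by simp [IsWeakDeriv], by simp⟩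
  add_mem' := by
    rintro p q ⟨hp, v, w, hv, hw, he⟩ ⟨hq, v', w', hv', hw', he'⟩
    refine ⟨Submodule.add_mem _ hp hq, v + v', w + w', fun i φ => ?_, fun i j φ => ?_, ?_⟩
    · simp only [Pi.add_apply, Prod.fst_add, inner_add_right, hv i φ, hv' i φ]; ring
    · simp only [Pi.add_apply, inner_add_right, hw i j φ, hw' i j φ]; ring
    · simp [he, he', Finset.sum_add_distrib]
  smul_mem' := by
    rintro c p ⟨hp, v, w, hv, hw, he⟩
    refine ⟨Submodule.smul_mem _ c hp, c • v, c • w, fun i φ => ?_, fun i j φ => ?_, ?_⟩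
    · simp only [Pi.smul_apply, Prod.smul_fst, inner_smul_right, hv i φ]; ring
    · simp only [Pi.smul_apply, inner_smul_right, hw i j φ]; ring
    · simp [he, Finset.smul_sum]

theorem laplacianGraph_single_valued (p : L2 Ω × L2 Ω) (hp : p ∈ laplacianGraph Ω)
    (h : p.1 = 0) : p.2 = 0 := by
  obtain ⟨-, v, w, hv, hw, he⟩ := hp
  have hv0 : ∀ i, v i = 0 := fun i => eq_zero_of_forall_inner_testL2 Ω _ fun φ => by
    rw [hv i φ, h, inner_zero_right, neg_zero]
  have hw0 : ∀ i j, w i j = 0 := fun i j => eq_zero_of_forall_inner_testL2 Ω _ fun φ => by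
    rw [hw i j φ, hv0, inner_zero_right, neg_zero]
  simp [he, hw0]

/-- The Dirichlet Laplacian, with domain `H²(Ω) ∩ H¹₀(Ω)`. -/
def laplacian : L2 Ω →ₗ.[ℂ] L2 Ω := (laplacianGraph Ω).toLinearPMap

/-- The pairs in `L²(Ω) × L²(Ω)` with both components in `V`. -/
def pairs (V : Submodule ℂ (L2 Ω)) : Submodule ℂ (StateSpace Ω) :=
  (V.prod V).comap (WithLp.linearEquiv 2 ℂ (L2 Ω × L2 Ω)).toLinearMap

instance pairs_finiteDimensional (V : Submodule ℂ (L2 Ω)) [FiniteDimensional ℂ V] :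
    FiniteDimensional ℂ (pairs Ω V) := by
  let f : pairs Ω V →ₗ[ℂ] V × V :=
    { toFun := fun x => (⟨x.1.fst, x.2.1⟩, ⟨x.1.snd, x.2.2⟩)
      map_add' := fun _ _ => rfl
      map_smul' := fun _ _ => rfl }
  refine FiniteDimensional.of_injective f fun x y h => ?_
  have h1 : x.1.fst = y.1.fst := congrArg (fun q : V × V => (q.1 : L2 Ω)) h
  have h2 : x.1.snd = y.1.snd := congrArg (fun q : V × V => (q.2 : L2 Ω)) h
  exact Subtype.ext (WithLp.ofLp_injective 2 (Prod.ext h1 h2))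

/-- The coefficients of the system `y_t - η₀ Δy + ν₀ y + η₁ z = u χ_𝒪`,
`z_t - β₀ Δz + (κ + ν₀) z - y = 0`. -/
structure Coeffs where
  η₀ : ℝ
  β₀ : ℝ
  κ : ℝ
  η₁ : ℝ
  ν₀ : ℝ
  η₀_pos : 0 < η₀
  β₀_pos : 0 < β₀
  κ_pos : 0 < κ
  nuhat_pos : 0 < ν₀ - (|η₁| + 1) / 2

/-- `ν̂ = ν₀ - (|η₁| + 1) / 2`. -/
def Coeffs.nuhat (c : Coeffs) : ℝ := c.ν₀ - (|c.η₁| + 1) / 2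

/-- The operator `A (y, z) = (η₀ Δy - ν₀ y - η₁ z, y + β₀ Δz - (κ + ν₀) z)` with domain
`(H²(Ω) ∩ H¹₀(Ω))²`. -/
def parabolicOp (c : Coeffs) : StateSpace Ω →ₗ.[ℂ] StateSpace Ω where
  domain := pairs Ω (laplacian Ω).domain
  toFun :=
    { toFun := fun x => WithLp.toLp 2
        ((c.η₀ : ℂ) • laplacian Ω ⟨(x : StateSpace Ω).fst, x.2.1⟩
            - (c.ν₀ : ℂ) • (x : StateSpace Ω).fst - (c.η₁ : ℂ) • (x : StateSpace Ω).snd,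
          (x : StateSpace Ω).fst + (c.β₀ : ℂ) • laplacian Ω ⟨(x : StateSpace Ω).snd, x.2.2⟩
            - ((c.κ : ℂ) + c.ν₀) • (x : StateSpace Ω).snd)
      map_add' := fun x y => by
        have h1 := (laplacian Ω).map_add ⟨x.1.fst, x.2.1⟩ ⟨y.1.fst, y.2.1⟩
        have h2 := (laplacian Ω).map_add ⟨x.1.snd, x.2.2⟩ ⟨y.1.snd, y.2.2⟩
        refine WithLp.ofLp_injective 2 (Prod.ext ?_ ?_)
        · refine (congrArg (fun q => (c.η₀ : ℂ) • q - (c.ν₀ : ℂ) • (x.1.fst + y.1.fst)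
            - (c.η₁ : ℂ) • (x.1.snd + y.1.snd)) h1).trans ?_
          simp only [WithLp.ofLp_add, Prod.fst_add]
          module
        · refine (congrArg (fun q => (x.1.fst + y.1.fst) + (c.β₀ : ℂ) • q
            - ((c.κ : ℂ) + c.ν₀) • (x.1.snd + y.1.snd)) h2).trans ?_
          simp only [WithLp.ofLp_add, Prod.snd_add]
          module
      map_smul' := fun r x => by
        have h1 := (laplacian Ω).map_smul r ⟨x.1.fst, x.2.1⟩
        have h2 := (laplacian Ω).map_smul r ⟨x.1.snd, x.2.2⟩
        refine WithLp.ofLp_injective 2 (Prod.ext ?_ ?_)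
        · refine (congrArg (fun q => (c.η₀ : ℂ) • q - (c.ν₀ : ℂ) • (r • x.1.fst)
            - (c.η₁ : ℂ) • (r • x.1.snd)) h1).trans ?_
          simp only [WithLp.ofLp_smul, Prod.smul_fst, RingHom.id_apply]
          module
        · refine (congrArg (fun q => (r • x.1.fst) + (c.β₀ : ℂ) • q
            - ((c.κ : ℂ) + c.ν₀) • (r • x.1.snd)) h2).trans ?_
          simp only [WithLp.ofLp_smul, Prod.smul_snd, RingHom.id_apply]
          module }

/-- Multiplication by the characteristic function of `𝒪` on `L²(Ω)`. -/
def mulIndicator (𝒪 : Opens (EuclideanSpace ℝ (Fin n))) : L2 Ω →L[ℂ] L2 Ω :=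
  LinearMap.mkContinuous
    { toFun := fun f => ((Lp.memLp f).indicator 𝒪.isOpen.measurableSet).toLp
      map_add' := fun f g => by
        rw [← MemLp.toLp_add, MemLp.toLp_eq_toLp_iff]
        filter_upwards [Lp.coeFn_add f g] with x hx
        by_cases hm : x ∈ 𝒪 <;> simp [Set.indicator, hm]
        simpa using hx
      map_smul' := fun r f => by
        rw [RingHom.id_apply, ← MemLp.toLp_const_smul, MemLp.toLp_eq_toLp_iff]
        filter_upwards [Lp.coeFn_smul r f] with x hx
        by_cases hm : x ∈ 𝒪 <;> simp [Set.indicator, hm]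
        simpa using hx } 1 (fun f => by
    rw [one_mul]
    refine Lp.norm_le_norm_of_ae_le ?_
    filter_upwards [((Lp.memLp f).indicator 𝒪.isOpen.measurableSet).coeFn_toLp] with x hx
    change ‖(((Lp.memLp f).indicator 𝒪.isOpen.measurableSet).toLp) x‖ ≤ _
    rw [hx]
    exact norm_indicator_le_norm_self _ _)

/-- The control operator `B f = (f χ_𝒪, 0)`. -/
def controlOp (𝒪 : Opens (EuclideanSpace ℝ (Fin n))) : L2 Ω →L[ℂ] StateSpace Ω :=
  (WithLp.prodContinuousLinearEquiv 2 ℂ (L2 Ω) (L2 Ω)).symm.toContinuousLinearMap.comp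
    ((mulIndicator Ω 𝒪).prod 0)

/-- `(y, z) ↦ ∇y` on `H¹₀(Ω) × H¹₀(Ω)`. -/
def gradFst : pairs Ω (H10 Ω) →ₗ[ℂ] L2Vec Ω where
  toFun Y := grad Ω ⟨Y.1.fst, Y.2.1⟩
  map_add' Y Y' := (grad Ω).map_add ⟨Y.1.fst, Y.2.1⟩ ⟨Y'.1.fst, Y'.2.1⟩
  map_smul' r Y := (grad Ω).map_smul r ⟨Y.1.fst, Y.2.1⟩

/-- `(y, z) ↦ ∇z` on `H¹₀(Ω) × H¹₀(Ω)`. -/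
def gradSnd : pairs Ω (H10 Ω) →ₗ[ℂ] L2Vec Ω where
  toFun Y := grad Ω ⟨Y.1.snd, Y.2.2⟩
  map_add' Y Y' := (grad Ω).map_add ⟨Y.1.snd, Y.2.2⟩ ⟨Y'.1.snd, Y'.2.2⟩
  map_smul' r Y := (grad Ω).map_smul r ⟨Y.1.snd, Y.2.2⟩

/-- The sesquilinear form `a` on `H¹₀(Ω) × H¹₀(Ω)` associated with `-A`. -/
def parabolicForm (c : Coeffs) (Y Φ : pairs Ω (H10 Ω)) : ℂ :=
  (c.η₀ : ℂ) * ⟪gradFst Ω Φ, gradFst Ω Y⟫_ℂ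
    + (c.η₁ : ℂ) * ⟪Φ.1.fst, Y.1.snd⟫_ℂ + (c.ν₀ : ℂ) * ⟪Φ.1.fst, Y.1.fst⟫_ℂ
    + (c.β₀ : ℂ) * ⟪gradSnd Ω Φ, gradSnd Ω Y⟫_ℂ
    + ((c.κ : ℂ) + c.ν₀) * ⟪Φ.1.snd, Y.1.snd⟫_ℂ - ⟪Φ.1.snd, Y.1.fst⟫_ℂ

theorem pairs_mono {V W : Submodule ℂ (L2 Ω)} (h : V ≤ W) : pairs Ω V ≤ pairs Ω W :=
  fun _ hx => ⟨h hx.1, h hx.2⟩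

theorem existsUnique_discreteOp (c : Coeffs) (V : Submodule ℂ (L2 Ω)) [FiniteDimensional ℂ V]
    (hV : V ≤ H10 Ω) : ∃! T : pairs Ω V →L[ℂ] pairs Ω V, ∀ Y Φ : pairs Ω V,
      ⟪Φ, -T Y⟫_ℂ = parabolicForm Ω c (Submodule.inclusion (pairs_mono Ω hV) Y)
        (Submodule.inclusion (pairs_mono Ω hV) Φ) := by
  let J := Submodule.inclusion (pairs_mono Ω hV)
  let s : pairs Ω V →ₗ[ℂ] pairs Ω V →ₗ⋆[ℂ] ℂ := LinearMap.mk₂'ₛₗ _ _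
    (fun Y Φ => parabolicForm Ω c (J Y) (J Φ))
    (fun Y Y' Φ => by
      simp only [parabolicForm, map_add, Submodule.coe_add, WithLp.add_fst, WithLp.add_snd, inner_add_right]
      ring)
    (fun r Y Φ => by
      simp only [parabolicForm, map_smul, Submodule.coe_smul, WithLp.smul_fst, WithLp.smul_snd, inner_smul_right,
        RingHom.id_apply, smul_eq_mul]
      ring)
    (fun Y Φ Φ' => by
      simp only [parabolicForm, map_add, Submodule.coe_add, WithLp.add_fst, WithLp.add_snd, inner_add_left]
      ring)
    (fun r Y Φ => by
      simp only [parabolicForm, map_smul, Submodule.coe_smul, WithLp.smul_fst, WithLp.smul_snd, inner_smul_left,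
        smul_eq_mul]
      ring)
  let e := stdOrthonormalBasis ℂ (pairs Ω V)
  let T : pairs Ω V →ₗ[ℂ] pairs Ω V := -∑ k, (s.flip (e k)).smulRight (e k)
  have hT : ∀ Y Φ : pairs Ω V, ⟪Φ, -T Y⟫_ℂ = s Y Φ := by
    intro Y Φ
    have hΦ : s Y Φ = ∑ k, ⟪Φ, e k⟫_ℂ * s Y (e k) := by
      conv_lhs => rw [← e.sum_repr' Φ]
      simp only [map_sum, LinearMap.map_smulₛₗ, smul_eq_mul, inner_conj_symm]
    rw [hΦ]
    simp only [T, LinearMap.neg_apply, neg_neg, LinearMap.sum_apply, LinearMap.smulRight_apply,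
      LinearMap.flip_apply, inner_sum, inner_smul_right]
    exact Finset.sum_congr rfl fun k _ => mul_comm _ _
  refine ⟨LinearMap.toContinuousLinearMap T, hT, fun T' hT' => ?_⟩
  · ext1 Y
    refine ext_inner_left ℂ fun Φ => ?_
    have h1 := hT' Y Φ
    rw [← neg_inj, ← inner_neg_right, ← inner_neg_right, h1]
    exact (hT Y Φ).symm

/-- The discrete operator `A_h` on `H_h = V × V`: the operator with
`⟨-A_h Y, Φ⟩ = a(Y, Φ)` for all `Y, Φ ∈ H_h`. -/
def discreteOp (c : Coeffs) (V : Submodule ℂ (L2 Ω)) [FiniteDimensional ℂ V]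
    (hV : V ≤ H10 Ω) : pairs Ω V →L[ℂ] pairs Ω V :=
  (existsUnique_discreteOp Ω c V hV).choose

end Parabolic

end

/-! The discrete closed loop is controlled differently far from the apex and near it. Far away,
`R(μ, A_{ω_h})` is of size `C₁/|μ - b|`, where `b = -ν̂ + ω`, and `B_h F_h` is bounded uniformly in
`h`, so a Neumann series (`mem_resolventSet_add_of_norm_le`) gives a uniform sectorial estimate. At
a remote real point `x` the second resolvent identity turns (A1d) and (A4) into norm convergence of
the lifted resolvents `ι R(x, A_{ω_h,F_h}) Π_h` to `S = R(x, A_{ω,F})`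
(`exists_closedLoop_resolvent_bound`).

What remains is a compact piece of the sector complement with apex `-g`, contained in `ρ(A_{ω,F})`
because `g < γ`. For `z` there, `1 + (z - x) S = (z - A_{ω,F}) S` is invertible. Invertibility is an
open condition, uniformly on compact sets, so it passes to the lifted discrete resolvents for small
`h` (`IsCompact.eventually_isUnit_one_add_smul`) and down to `H_h`
(`mem_resolventSet_of_isUnit_one_add`).

For the decay of the semigroup, the Laplace transform of `s e^{sT}` is `R(z, T)²`, which is `O(|z +
g|⁻²)` and hence integrable on vertical lines. Fourier inversion on the line `Re z = -g + 1/t`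
bounds `e^{tT}` by a constant free of the dimension (`norm_exp_le_of_resolvent_le`). -/

open scoped FourierTransform

/-! ### From resolvent bounds to decay of the exponential -/

section FiniteDimensionalSemigroup

variable {E : Type*} [NormedAddCommGroup E] [NormedSpace ℂ E] [CompleteSpace E]

theorem hasDerivAt_exp_real_smul_apply (T : E →L[ℂ] E) (v : E) (s : ℝ) :
    HasDerivAt (fun r : ℝ => NormedSpace.exp ((r : ℂ) • T) v)
      (NormedSpace.exp ((s : ℂ) • T) (T v)) s := by
  have h := (hasDerivAt_exp_smul_const (𝕂 := ℂ) T (s : ℂ)).scomp s Complex.ofRealCLM.hasDerivAt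
  have h2 := ((ContinuousLinearMap.apply ℂ E v).restrictScalars ℝ).hasFDerivAt.comp_hasDerivAt s h
  simpa [Function.comp_def] using h2

theorem exp_smul_sub_smul_one (T : E →L[ℂ] E) (z s : ℂ) :
    NormedSpace.exp (s • (T - z • 1)) = Complex.exp (-(s * z)) • NormedSpace.exp (s • T) := by
  have h1 : s • (T - z • (1 : E →L[ℂ] E)) = algebraMap ℂ (E →L[ℂ] E) (-(s * z)) + s • T := by
    rw [Algebra.algebraMap_eq_smul_one]; module
  rw [h1, NormedSpace.exp_add_of_commute_of_mem_ball (𝕂 := ℂ) (Algebra.commutes _ _)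
    ((NormedSpace.expSeries_radius_eq_top ℂ (E →L[ℂ] E)).symm ▸ edist_lt_top _ _)
    ((NormedSpace.expSeries_radius_eq_top ℂ (E →L[ℂ] E)).symm ▸ edist_lt_top _ _),
    ← NormedSpace.algebraMap_exp_comm, ← Algebra.smul_def, Complex.exp_eq_exp_ℂ]

/-- Induction on `k`: the derivative of `e^{sN} v` is `e^{sN} N v`, and `N v` is killed by one power
less, so the mean value inequality costs one factor `1 + s`. -/
theorem exists_norm_exp_apply_le_of_pow_apply_eq_zero (N : E →L[ℂ] E) (k : ℕ) :
    ∀ v : E, (N ^ k) v = 0 → ∃ C : ℝ, 0 ≤ C ∧ ∀ s : ℝ, 0 ≤ s →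
      ‖NormedSpace.exp ((s : ℂ) • N) v‖ ≤ C * (1 + s) ^ k := by
  induction k with
  | zero =>
    intro v hv
    have : v = 0 := by simpa using hv
    exact ⟨0, le_rfl, by simp [this]⟩
  | succ k ih =>
    intro v hv
    obtain ⟨C, hC, h⟩ := ih (N v) (by simpa [pow_succ] using hv)
    refine ⟨C + ‖v‖, by positivity, fun s hs => ?_⟩
    have hm := norm_image_sub_le_of_norm_deriv_le_segment'
      (f := fun r : ℝ => NormedSpace.exp ((r : ℂ) • N) v) (C := C * (1 + s) ^ k)
      (fun r _ => (hasDerivAt_exp_real_smul_apply N v r).hasDerivWithinAt)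
      (fun r hr => (h r hr.1).trans (by gcongr; exacts [by linarith [hr.1], hr.2.le]))
      s ⟨hs, le_rfl⟩
    have h0 : NormedSpace.exp (((0 : ℝ) : ℂ) • N) v = v := by simp [NormedSpace.exp_zero]
    simp only [h0, sub_zero] at hm
    have h1 : ‖NormedSpace.exp ((s : ℂ) • N) v‖ ≤
        ‖NormedSpace.exp ((s : ℂ) • N) v - v‖ + ‖v‖ := by
      simpa using norm_add_le (NormedSpace.exp ((s : ℂ) • N) v - v) v
    have h2 : (1 : ℝ) ≤ (1 + s) ^ (k + 1) := one_le_pow₀ (by linarith)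
    have h3 : C * (1 + s) ^ k * s ≤ C * (1 + s) ^ (k + 1) := by
      rw [pow_succ, ← mul_assoc]
      gcongr
      linarith
    nlinarith [norm_nonneg v]

/-- On a finite dimensional space, orbits of `e^{sT}` decay faster than `e^{as}` if the
spectrum of `T` lies in `Re < a`. -/
theorem exists_norm_exp_apply_le [FiniteDimensional ℂ E] (T : E →L[ℂ] E) (a : ℝ)
    (hT : ∀ z : ℂ, a ≤ z.re → z ∈ resolventSet ℂ T) (v : E) :
    ∃ C b : ℝ, 0 ≤ C ∧ 0 < b ∧ ∀ s : ℝ, 0 ≤ s →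
      ‖NormedSpace.exp ((s : ℂ) • T) v‖ ≤ C * Real.exp ((a - b) * s) := by
  have hv : v ∈ ⨆ z : ℂ, Module.End.maxGenEigenspace (T : E →ₗ[ℂ] E) z := by
    rw [Module.End.iSup_maxGenEigenspace_eq_top]; trivial
  induction hv using Submodule.iSup_induction' with
  | zero => exact ⟨0, 1, le_rfl, one_pos, by simp⟩
  | add x y _ _ hx hy =>
    obtain ⟨C, b, hC, hb, h⟩ := hx
    obtain ⟨C', b', hC', hb', h'⟩ := hy
    refine ⟨C + C', min b b', by positivity, lt_min hb hb', fun s hs => ?_⟩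
    rw [map_add, add_mul]
    refine (norm_add_le _ _).trans (add_le_add ((h s hs).trans ?_) ((h' s hs).trans ?_)) <;>
      gcongr
    exacts [min_le_left _ _, min_le_right _ _]
  | mem z v hv =>
    obtain ⟨k, hk⟩ := (Module.End.mem_maxGenEigenspace _ _ _).1 hv
    have hk' : ((T - z • 1) ^ k) v = 0 := by
      rw [← hk, ← ContinuousLinearMap.coe_coe]
      congr 1
      rw [ContinuousLinearMap.toLinearMap_pow]
      rfl
    by_cases hz : a ≤ z.re
    -- Here `T - z` is invertible, so the generalized eigenspace is trivial.
    · have hu : IsUnit ((T - z • 1) ^ k) := by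
        have := (hT z hz).neg
        rw [neg_sub, Algebra.algebraMap_eq_smul_one] at this
        exact this.pow k
      obtain ⟨w, hw⟩ := hu.exists_left_inv
      have : v = 0 := by
        have := congrArg (fun S : E →L[ℂ] E => S v) hw
        simpa [hk'] using this.symm
      exact ⟨0, 1, le_rfl, one_pos, by simp [this]⟩
    · push Not at hz
      obtain ⟨C, hC, h⟩ := exists_norm_exp_apply_le_of_pow_apply_eq_zero _ k v hk'
      -- Half of the gap absorbs the polynomial factor, through `(1 + s)^k ≤ (k!/b^k) e^{b(1+s)}`;
      -- the other half survives as decay, since `Re z + b = a - b`.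
      set b := (a - z.re) / 2 with hb
      have hb0 : 0 < b := by rw [hb]; linarith
      refine ⟨C * (k.factorial / b ^ k * Real.exp b), b, by positivity, hb0, fun s hs => ?_⟩
      have h1 := h s hs
      rw [exp_smul_sub_smul_one, smul_apply, norm_smul, Complex.norm_exp] at h1
      have hre : (-((s : ℂ) * z)).re = -(s * z.re) := by simp
      rw [hre] at h1
      have h2 := Real.pow_div_factorial_le_exp (b * (1 + s)) (by positivity) k
      have h3 : (1 + s) ^ k ≤ k.factorial / b ^ k * Real.exp (b * (1 + s)) := by
        rw [mul_pow, div_le_iff₀ (by positivity)] at h2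
        rw [div_mul_eq_mul_div, le_div_iff₀ (by positivity)]
        linarith
      have h4 : ‖NormedSpace.exp ((s : ℂ) • T) v‖ =
          Real.exp (s * z.re) * (Real.exp (-(s * z.re)) * ‖NormedSpace.exp ((s : ℂ) • T) v‖) := by
        rw [← mul_assoc, ← Real.exp_add]; simp
      calc _ ≤ Real.exp (s * z.re) * (C * (k.factorial / b ^ k * Real.exp (b * (1 + s)))) := by
            rw [h4]; exact mul_le_mul_of_nonneg_left (h1.trans (by gcongr)) (by positivity)
        _ = C * (k.factorial / b ^ k * (Real.exp (s * z.re) * Real.exp (b * (1 + s)))) := by ring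
        _ = _ := by
          rw [mul_assoc C, mul_assoc (_ / _), ← Real.exp_add, ← Real.exp_add]
          congr 3
          rw [hb]; ring

/-- Since `M Q = 1`, an antiderivative of the integrand is `s e^{sM} Q v - e^{sM} Q² v`; it tends to
`0` at infinity and equals `-Q² v` at `0`. The weight `s` is there to produce the square of `Q`. -/
theorem integral_smul_exp_apply_Ioi (M Q : E →L[ℂ] E) (hQ : M * Q = 1)
    (hM : ∀ v : E, ∃ C b : ℝ, 0 ≤ C ∧ 0 < b ∧ ∀ s : ℝ, 0 ≤ s →
      ‖NormedSpace.exp ((s : ℂ) • M) v‖ ≤ C * Real.exp (-b * s)) (v : E) :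
    IntegrableOn (fun s : ℝ => (s : ℂ) • NormedSpace.exp ((s : ℂ) • M) v) (Set.Ioi 0) ∧
      ∫ s in Set.Ioi (0 : ℝ), (s : ℂ) • NormedSpace.exp ((s : ℂ) • M) v = Q (Q v) := by
  have hMQ : ∀ x, M (Q x) = x := fun x => congrArg (fun S : E →L[ℂ] E => S x) hQ
  have hd := fun x => hasDerivAt_exp_real_smul_apply M x
  have hcont : ∀ x, Continuous fun s : ℝ => NormedSpace.exp ((s : ℂ) • M) x := fun x =>
    continuous_iff_continuousAt.2 fun s => (hd x s).continuousAt
  have hbound : ∀ x, ∃ C b : ℝ, 0 ≤ C ∧ 0 < b ∧ ∀ s : ℝ, 0 ≤ s →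
      ‖(s : ℂ) • NormedSpace.exp ((s : ℂ) • M) x‖ ≤ C * Real.exp (-b * s) := by
    intro x
    obtain ⟨C, b, hC, hb, h⟩ := hM x
    refine ⟨C * (2 / b), b / 2, by positivity, by positivity, fun s hs => ?_⟩
    -- The weight `s` is paid for with half of the decay rate.
    have h1 : s ≤ 2 / b * Real.exp (b / 2 * s) := by
      have := Real.add_one_le_exp (b / 2 * s)
      rw [div_mul_eq_mul_div, le_div_iff₀ hb]
      linarith
    rw [norm_smul, Complex.norm_real, Real.norm_of_nonneg hs]
    calc _ ≤ (2 / b * Real.exp (b / 2 * s)) * (C * Real.exp (-b * s)) :=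
          mul_le_mul h1 (h s hs) (norm_nonneg _) (by positivity)
      _ = C * (2 / b) * (Real.exp (b / 2 * s) * Real.exp (-b * s)) := by ring
      _ = _ := by rw [← Real.exp_add]; ring_nf
  have hdecay : ∀ {f : ℝ → E} {C b : ℝ}, 0 < b →
      (∀ s : ℝ, 0 ≤ s → ‖f s‖ ≤ C * Real.exp (-b * s)) → Tendsto f atTop (𝓝 0) := by
    intro f C b hb h
    refine squeeze_zero_norm' (eventually_atTop.2 ⟨0, h⟩) ?_
    have h2 : Tendsto (fun s : ℝ => Real.exp (-b * s)) atTop (𝓝 0) :=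
      Real.tendsto_exp_atBot.comp (tendsto_id.const_mul_atTop_of_neg (neg_neg_of_pos hb))
    simpa using h2.const_mul C
  have hint : IntegrableOn (fun s : ℝ => (s : ℂ) • NormedSpace.exp ((s : ℂ) • M) v)
      (Set.Ioi 0) := by
    obtain ⟨C, b, hC, hb, h⟩ := hbound v
    refine Integrable.mono' ((exp_neg_integrableOn_Ioi 0 hb).const_mul C)
      (by have := hcont v; fun_prop) ?_
    filter_upwards [ae_restrict_mem measurableSet_Ioi] with s hs using h s (le_of_lt hs)
  refine ⟨hint, ?_⟩
  have hderiv : ∀ s : ℝ, HasDerivAt (fun s : ℝ => (s : ℂ) • NormedSpace.exp ((s : ℂ) • M) (Q v)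
      - NormedSpace.exp ((s : ℂ) • M) (Q (Q v)))
      ((s : ℂ) • NormedSpace.exp ((s : ℂ) • M) v) s := by
    intro s
    have h := (Complex.ofRealCLM.hasDerivAt (x := s)).smul (hd (Q v) s) |>.sub (hd (Q (Q v)) s)
    refine HasDerivAt.congr_deriv h ?_
    simp [hMQ]
  have hlim : Tendsto (fun s : ℝ => (s : ℂ) • NormedSpace.exp ((s : ℂ) • M) (Q v)
      - NormedSpace.exp ((s : ℂ) • M) (Q (Q v))) atTop (𝓝 0) := by
    obtain ⟨C, b, -, hb, h⟩ := hbound (Q v)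
    obtain ⟨C', b', -, hb', h'⟩ := hM (Q (Q v))
    simpa using (hdecay hb h).sub (hdecay hb' h')
  rw [integral_Ioi_of_hasDerivAt_of_tendsto' (fun s _ => hderiv s) hint hlim]
  simp [NormedSpace.exp_zero]

theorem norm_exp_smul_sub_smul_one_apply (T : E →L[ℂ] E) (z : ℂ) (s : ℝ) (v : E) :
    ‖NormedSpace.exp ((s : ℂ) • (T - z • 1)) v‖ =
      Real.exp (-(s * z.re)) * ‖NormedSpace.exp ((s : ℂ) • T) v‖ := by
  rw [exp_smul_sub_smul_one, smul_apply, norm_smul, Complex.norm_exp]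
  simp

/-- Apply the previous integral to `M = T - z` and `Q = -R(z, T)`; the two signs cancel. Finite
dimension only guarantees convergence and contributes no constant. -/
theorem integral_smul_exp_sub_eq_resolvent [FiniteDimensional ℂ E] (T : E →L[ℂ] E) (z : ℂ)
    (hT : ∀ w : ℂ, z.re ≤ w.re → w ∈ resolventSet ℂ T) (v : E) :
    IntegrableOn (fun s : ℝ => (s : ℂ) • NormedSpace.exp ((s : ℂ) • (T - z • 1)) v) (Set.Ioi 0) ∧
      ∫ s in Set.Ioi (0 : ℝ), (s : ℂ) • NormedSpace.exp ((s : ℂ) • (T - z • 1)) v =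
        resolvent T z (resolvent T z v) := by
  have hQ : (T - z • 1) * (-resolvent T z) = 1 := by
    have := Ring.mul_inverse_cancel _ (hT z le_rfl)
    rw [resolvent, mul_neg, ← neg_mul, neg_sub, ← Algebra.algebraMap_eq_smul_one]
    exact this
  have h := integral_smul_exp_apply_Ioi (T - z • 1) (-resolvent T z) hQ (fun v => by
    obtain ⟨C, b, hC, hb, h⟩ := exists_norm_exp_apply_le T z.re hT v
    refine ⟨C, b, hC, hb, fun s hs => ?_⟩
    rw [norm_exp_smul_sub_smul_one_apply]
    refine (mul_le_mul_of_nonneg_left (h s hs) (Real.exp_nonneg _)).trans (le_of_eq ?_)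
    rw [mul_left_comm, ← Real.exp_add]
    ring_nf) v
  simpa using h

/-- Resolvent bounds `‖R(z, T)‖ ≤ C / |z + g|` on the half plane `Re z > -g` give the decay
`‖e^{tT}‖ ≤ (C² e / 2) e^{-gt}`, with a constant that does not depend on the dimension. -/
theorem norm_exp_le_of_resolvent_le [FiniteDimensional ℂ E] (T : E →L[ℂ] E) (g C : ℝ)
    (hT : ∀ z : ℂ, -g < z.re → z ∈ resolventSet ℂ T)
    (hR : ∀ z : ℂ, -g < z.re → ‖resolvent T z‖ ≤ C / ‖z + g‖) (t : ℝ) (ht : 0 < t) :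
    ‖NormedSpace.exp ((t : ℂ) • T)‖ ≤ C ^ 2 * Real.exp 1 / 2 * Real.exp (-g * t) := by
  refine ContinuousLinearMap.opNorm_le_bound _ (by positivity) fun v => ?_
  -- At distance `1/t` from `-g`, the factor `e^{ta}` is just `e · e^{-gt}`.
  set a : ℝ := -g + 1 / t with ha
  have hat : -g < a := by rw [ha]; linarith [one_div_pos.2 ht]
  -- Extension by zero to `s ≤ 0`, continuous at `0` because of the weight `s`, so Fourier inversion
  -- holds pointwise.
  let f : ℝ → E := fun s => ((max s 0 : ℝ) : ℂ) • NormedSpace.exp ((s : ℂ) • (T - (a : ℂ) • 1)) v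
  have hker := fun z : ℂ => fun hz : z.re = a => integral_smul_exp_sub_eq_resolvent T z
    (fun w hw => hT w (hat.trans_le (hz ▸ hw))) v
  have hcont : Continuous f := by
    have : Continuous fun s : ℝ => NormedSpace.exp ((s : ℂ) • (T - (a : ℂ) • 1)) v :=
      continuous_iff_continuousAt.2 fun s =>
        (hasDerivAt_exp_real_smul_apply (T - (a : ℂ) • 1) v s).continuousAt
    fun_prop
  have hsupp : ∀ s ∉ Set.Ioi (0 : ℝ), f s = 0 := fun s hs => by
    simp only [f, max_eq_right (not_lt.1 (Set.mem_Ioi.not.1 hs))]; simp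
  have hf : Integrable f := by
    rw [← integrableOn_iff_integrable_of_support_subset (s := Set.Ioi 0)
      (Function.support_subset_iff'.2 hsupp)]
    refine (hker a (by simp)).1.congr_fun (fun s hs => ?_) measurableSet_Ioi
    simp only [f, max_eq_left (Set.mem_Ioi.1 hs).le]
  have hF : ∀ ξ : ℝ, 𝓕 f ξ = resolvent T (a + 2 * Real.pi * ξ * Complex.I)
      (resolvent T (a + 2 * Real.pi * ξ * Complex.I) v) := by
    intro ξ
    rw [← (hker (a + 2 * Real.pi * ξ * Complex.I) (by simp)).2,
      Real.fourier_real_eq_integral_exp_smul,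
      ← setIntegral_eq_integral_of_forall_compl_eq_zero (s := Set.Ioi 0)
        (fun s hs => by rw [hsupp s hs, smul_zero])]
    refine setIntegral_congr_fun measurableSet_Ioi fun s hs => ?_
    simp only [f, max_eq_left (Set.mem_Ioi.1 hs).le, exp_smul_sub_smul_one, smul_apply]
    rw [smul_comm, ← mul_smul (Complex.exp _), ← Complex.exp_add]
    congr 3
    push_cast; ring
  -- Each of the two resolvents gives `C/|z + g|`, and `|z + g|² = t⁻² (1 + (2πtξ)²)` on this line.
  have hnorm : ∀ ξ : ℝ, ‖𝓕 f ξ‖ ≤ C ^ 2 * t ^ 2 * ‖v‖ * (1 + (2 * Real.pi * t * ξ) ^ 2)⁻¹ := by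
    intro ξ
    rw [hF]
    set z : ℂ := a + 2 * Real.pi * ξ * Complex.I with hz
    have hzr : -g < z.re := by simpa [hz] using hat
    have hn : ‖z + g‖ ^ 2 = t⁻¹ ^ 2 * (1 + (2 * Real.pi * t * ξ) ^ 2) := by
      rw [← Complex.normSq_eq_norm_sq, Complex.normSq_apply]
      simp only [hz, ha]
      simp
      field_simp
    calc _ ≤ ‖resolvent T z‖ * (‖resolvent T z‖ * ‖v‖) :=
          ContinuousLinearMap.le_of_opNorm_le_of_le _ le_rfl (ContinuousLinearMap.le_opNorm _ _)
      _ ≤ (C / ‖z + g‖) * ((C / ‖z + g‖) * ‖v‖) := by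
        have := hR z hzr
        have h0 := (norm_nonneg _).trans this
        gcongr
      _ = C ^ 2 * ‖v‖ / ‖z + g‖ ^ 2 := by ring
      _ = _ := by rw [hn]; field_simp
  have hscale : 2 * Real.pi * t ≠ 0 := by positivity
  have hdom : Integrable fun ξ : ℝ => C ^ 2 * t ^ 2 * ‖v‖ * (1 + (2 * Real.pi * t * ξ) ^ 2)⁻¹ :=
    (integrable_inv_one_add_sq.comp_mul_left' hscale).const_mul _
  have hFcont : Continuous (𝓕 f) :=
    VectorFourier.fourierIntegral_continuous Real.continuous_fourierChar (by fun_prop) hf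
  have hFint : Integrable (𝓕 f) :=
    hdom.mono' hFcont.aestronglyMeasurable (Eventually.of_forall hnorm)
  have hinv : f t = 𝓕⁻ (𝓕 f) t := (hf.fourierInv_fourier_eq hFint hcont.continuousAt).symm
  -- The integral of `(1 + (2πtξ)²)⁻¹` over `ξ` is `π/(2πt) = 1/(2t)`.
  have h1 : ‖f t‖ ≤ C ^ 2 * t / 2 * ‖v‖ := by
    rw [hinv, Real.fourierInv_eq_fourier_neg]
    refine (VectorFourier.norm_fourierIntegral_le_integral_norm _ _ _ _ _).trans ?_
    refine (integral_mono hFint.norm hdom hnorm).trans (le_of_eq ?_)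
    rw [integral_const_mul, Measure.integral_comp_mul_left (fun x : ℝ => (1 + x ^ 2)⁻¹),
      integral_univ_inv_one_add_sq, abs_of_pos (by positivity), smul_eq_mul]
    field_simp
  have h2 : ‖f t‖ = t * (Real.exp (-(t * a)) * ‖NormedSpace.exp ((t : ℂ) • T) v‖) := by
    simp only [f, norm_smul, norm_exp_smul_sub_smul_one_apply, max_eq_left ht.le,
      Complex.norm_real, Real.norm_of_nonneg ht.le, Complex.ofReal_re]
  rw [h2, mul_div_right_comm, mul_comm _ t, mul_assoc, mul_le_mul_iff_right₀ ht] at h1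
  have h3 : Real.exp (t * a) = Real.exp 1 * Real.exp (-g * t) := by
    rw [← Real.exp_add, ha]; congr 1; field_simp; ring
  calc ‖NormedSpace.exp ((t : ℂ) • T) v‖
      = Real.exp (t * a) * (Real.exp (-(t * a)) * ‖NormedSpace.exp ((t : ℂ) • T) v‖) := by
        rw [← mul_assoc, ← Real.exp_add]; simp
    _ ≤ Real.exp (t * a) * (C ^ 2 / 2 * ‖v‖) := by gcongr
    _ = _ := by rw [h3]; ring

end FiniteDimensionalSemigroup

/-! ### Geometry of sectors -/

section SectorGeometry

/-- Cosine decreases strictly on `[0, π]`, so `|arg (z - a)| < θ` becomes an inequality between norm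
and real part. The apex is listed apart because there the inequality reads `0 < 0`. -/
theorem mem_compl_sector_iff {a θ : ℝ} (h0 : 0 ≤ θ) (hθ : θ ≤ Real.pi) (z : ℂ) :
    z ∈ (sector a θ)ᶜ ↔ z = a ∨ Real.cos θ * ‖z - a‖ < (z - a).re := by
  rw [Set.mem_compl_iff, not_iff_comm, not_or, not_lt]
  constructor
  · rintro ⟨hz, hle⟩
    have hpos : 0 < ‖z - a‖ := norm_pos_iff.2 (sub_ne_zero.2 hz)
    refine ⟨‖z - a‖, (z - a).arg, hpos, Complex.arg_mem_Ioc _, ?_, ?_⟩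
    · by_contra! hlt
      have := Real.cos_lt_cos_of_nonneg_of_le_pi (abs_nonneg _) hθ hlt
      rw [Real.cos_abs] at this
      have h2 := Complex.norm_mul_cos_arg (z - a)
      nlinarith
    · rw [Complex.norm_mul_exp_arg_mul_I]; ring
  · rintro ⟨r, φ, hr, hφ, hle, rfl⟩
    have hn : ‖(a + r * Complex.exp (φ * Complex.I) : ℂ) - a‖ = r := by
      rw [add_sub_cancel_left, norm_mul, Complex.norm_exp_ofReal_mul_I, mul_one, Complex.norm_real,
        Real.norm_of_nonneg hr.le]
    refine ⟨fun h => ?_, ?_⟩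
    · rw [h, sub_self, norm_zero] at hn
      exact hr.ne hn
    · rw [hn, add_sub_cancel_left, Complex.re_ofReal_mul, Complex.exp_ofReal_mul_I_re, mul_comm]
      gcongr
      rw [← Real.cos_abs φ]
      exact Real.cos_le_cos_of_nonneg_of_le_pi h0 (abs_le.2 ⟨hφ.1.le, hφ.2⟩) hle

theorem ofReal_mem_compl_sector {a θ : ℝ} (h0 : 0 < θ) (hθ : θ ≤ Real.pi) {x : ℝ} (hx : a < x) :
    (x : ℂ) ∈ (sector a θ)ᶜ := by
  rw [mem_compl_sector_iff h0.le hθ]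
  right
  rw [← Complex.ofReal_sub, Complex.norm_real, Complex.ofReal_re,
    Real.norm_of_nonneg (sub_pos.2 hx).le]
  have : Real.cos θ < Real.cos 0 := Real.cos_lt_cos_of_nonneg_of_le_pi le_rfl hθ h0
  rw [Real.cos_zero] at this
  nlinarith

/-- A closed sector complement lies in an open one with apex further left and larger angle. -/
theorem mem_compl_sector_of_apex_lt {a b φ θ : ℝ} (hba : b < a) (hφ : 0 ≤ φ) (hφθ : φ < θ)
    (hθ : θ ≤ Real.pi) {z : ℂ} (hz : Real.cos φ * ‖z - a‖ ≤ (z - a).re) (hcos : Real.cos φ ≤ 0) :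
    z ∈ (sector b θ)ᶜ := by
  rw [mem_compl_sector_iff (hφ.trans hφθ.le) hθ]
  right
  have h1 : ‖z - a‖ ≤ ‖z - b‖ + (a - b) := by
    have := norm_sub_le (z - b) ((a : ℂ) - b)
    rwa [sub_sub_sub_cancel_right, ← Complex.ofReal_sub a b, Complex.norm_real,
      Real.norm_of_nonneg (sub_pos.2 hba).le] at this
  have h2 : Real.cos θ < Real.cos φ := Real.cos_lt_cos_of_nonneg_of_le_pi hφ hθ hφθ
  have h3 : -1 < Real.cos φ := by
    rw [← Real.cos_pi]; exact Real.cos_lt_cos_of_nonneg_of_le_pi hφ le_rfl (hφθ.trans_le hθ)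
  simp only [Complex.sub_re, Complex.ofReal_re] at hz ⊢
  -- `Re (z - b) ≥ cos φ ‖z - b‖ + (1 + cos φ)(a - b)`, and the last term is positive, which also
  -- covers `z = a`.
  nlinarith [norm_nonneg (z - b), mul_le_mul_of_nonpos_left h1 hcos]

/-- Away from a ball, a sector complement lies in any sector complement with larger angle. -/
theorem mem_compl_sector_of_norm_ge {a b φ θ : ℝ} (hφ : 0 ≤ φ) (hφθ : φ < θ)
    (hθ : θ ≤ Real.pi) {z : ℂ} (hz : Real.cos φ * ‖z - a‖ < (z - a).re) (hcos : Real.cos θ ≤ 0)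
    (hr : 2 * |a - b| / (Real.cos φ - Real.cos θ) ≤ ‖z - a‖) : z ∈ (sector b θ)ᶜ := by
  rw [mem_compl_sector_iff (hφ.trans hφθ.le) hθ]
  right
  have h1 : ‖z - a‖ ≤ ‖z - b‖ + |a - b| := by
    have := norm_sub_le (z - b) ((a : ℂ) - b)
    rwa [sub_sub_sub_cancel_right, ← Complex.ofReal_sub a b, Complex.norm_real,
      Real.norm_eq_abs] at this
  have h2 : Real.cos θ < Real.cos φ := Real.cos_lt_cos_of_nonneg_of_le_pi hφ hθ hφθ
  rw [div_le_iff₀ (sub_pos.2 h2)] at hr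
  simp only [Complex.sub_re, Complex.ofReal_re] at hz ⊢
  -- Moving the apex costs at most `|a - b|` in the real part and again in the norm term; the gap
  -- `(cos φ - cos θ) ‖z - a‖` pays for both.
  nlinarith [neg_abs_le (a - b), abs_nonneg (a - b), Real.neg_one_le_cos θ,
    mul_le_mul_of_nonpos_left h1 hcos]

end SectorGeometry

/-! ### Resolvent identities for unbounded operators -/

section UnboundedResolvent

variable {H : Type*} [NormedAddCommGroup H] [InnerProductSpace ℂ H]

theorem isResolventAt_resolventOp {A : H →ₗ.[ℂ] H} {μ : ℂ} (h : μ ∈ rho A) :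
    IsResolventAt A μ (resolventOp A μ) := by
  rw [resolventOp, dif_pos h]
  exact h.choose_spec

theorem IsResolventAt.resolvent_identity {A : H →ₗ.[ℂ] H} {μ z : ℂ} {R S : H →L[ℂ] H}
    (hR : IsResolventAt A μ R) (hS : IsResolventAt A z S) : R - S = (z - μ) • (R * S) := by
  ext x
  obtain ⟨hx, h1⟩ := hS.1 x
  have h2 := hR.2 ⟨S x, hx⟩
  have h3 : μ • S x - A ⟨S x, hx⟩ = x - (z - μ) • S x := by
    rw [← sub_eq_zero]
    calc _ = (z • S x - A ⟨S x, hx⟩) - x := by module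
      _ = 0 := by rw [h1, sub_self]
  simp only [h3, map_sub, map_smul] at h2
  simp only [sub_apply, smul_apply, mul_apply_eq_comp]
  rw [sub_eq_iff_eq_add, add_comm]
  exact sub_eq_iff_eq_add.1 h2

/-- The operator is `(z - A) R(μ)`, with inverse `(μ - A) R(z) = 1 - (z - μ) R(z)`. It encodes `z ∈
ρ(A)` in a bounded operator, to which norm convergence applies. -/
theorem IsResolventAt.isUnit_one_add {A : H →ₗ.[ℂ] H} {μ z : ℂ} {R S : H →L[ℂ] H}
    (hR : IsResolventAt A μ R) (hS : IsResolventAt A z S) : IsUnit (1 + (z - μ) • R) := by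
  have h1 := hR.resolvent_identity hS
  have h2 := hS.resolvent_identity hR
  refine ⟨⟨1 + (z - μ) • R, 1 - (z - μ) • S, ?_, ?_⟩, rfl⟩
  · have : (1 + (z - μ) • R) * (1 - (z - μ) • S) =
        1 + (z - μ) • ((R - S) - (z - μ) • (R * S)) := by
      simp only [mul_sub, add_mul, one_mul, mul_one, smul_mul_assoc, mul_smul_comm]
      module
    rw [this, h1, sub_self, smul_zero, add_zero]
  · have : (1 - (z - μ) • S) * (1 + (z - μ) • R) =
        1 - (z - μ) • ((S - R) - (μ - z) • (S * R)) := by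
      simp only [mul_add, sub_mul, one_mul, mul_one, smul_mul_assoc, mul_smul_comm]
      module
    rw [this, h2, sub_self, smul_zero, sub_zero]

/-- The second resolvent identity for a bounded perturbation. -/
theorem IsResolventAt.eq_add_of_addBounded {A : H →ₗ.[ℂ] H} {D : H →L[ℂ] H} {μ : ℂ}
    {R S : H →L[ℂ] H} (hR : IsResolventAt A μ R) (hS : IsResolventAt (addBounded A D) μ S) :
    S = R + R * D * S := by
  ext x
  obtain ⟨hx, h1⟩ := hS.1 x
  have hx' : S x ∈ A.domain := hx
  have h2 : addBounded A D ⟨S x, hx⟩ = D (S x) + A ⟨S x, hx'⟩ := rfl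
  rw [h2] at h1
  have h3 := hR.2 ⟨S x, hx'⟩
  have h4 : μ • S x - A ⟨S x, hx'⟩ = x + D (S x) := by
    rw [← sub_eq_zero]
    calc _ = (μ • S x - (D (S x) + A ⟨S x, hx'⟩)) - x := by module
      _ = 0 := by rw [h1, sub_self]
  simp only [h4, map_add] at h3
  simpa using h3.symm

end UnboundedResolvent

/-! ### Stability of invertibility under perturbation -/

section Perturbation

/-- Near an operator `S` and for `μ` in a compact set where `1 + (μ - μ₀) S` is invertible,
the inverses of `1 + (μ - μ₀) S'` exist and are uniformly bounded. -/
theorem IsCompact.eventually_isUnit_one_add_smul {𝔸 : Type*} [NormedRing 𝔸] [NormedAlgebra ℂ 𝔸]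
    [CompleteSpace 𝔸] {K : Set ℂ} (hK : IsCompact K) (μ₀ : ℂ) (S : 𝔸)
    (h : ∀ μ ∈ K, IsUnit (1 + (μ - μ₀) • S)) :
    ∃ M : ℝ, 0 < M ∧ ∀ᶠ S' in 𝓝 S, ∀ μ ∈ K, IsUnit (1 + (μ - μ₀) • S') ∧
      ‖Ring.inverse (1 + (μ - μ₀) • S')‖ ≤ M := by
  have hcont : Continuous fun p : 𝔸 × ℂ => 1 + (p.2 - μ₀) • p.1 := by fun_prop
  have hinv : ∀ μ ∈ K, ContinuousAt (fun p : 𝔸 × ℂ => Ring.inverse (1 + (p.2 - μ₀) • p.1))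
      (S, μ) := fun μ hμ => by
    obtain ⟨u, hu⟩ := h μ hμ
    have := NormedRing.inverse_continuousAt u
    rw [hu] at this
    exact ContinuousAt.comp (f := fun p : 𝔸 × ℂ => 1 + (p.2 - μ₀) • p.1) (x := (S, μ)) this
      hcont.continuousAt
  obtain ⟨M, hM⟩ := hK.exists_bound_of_continuousOn
    (f := fun μ => Ring.inverse (1 + (μ - μ₀) • S)) fun μ hμ =>
      (ContinuousAt.comp (f := fun μ : ℂ => (S, μ)) (hinv μ hμ)
        (by fun_prop)).continuousWithinAt
  -- The slack `1` makes the bound at `S` strict, hence valid nearby; the absolute value covers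
  -- empty `K`, where `M` may be negative.
  refine ⟨|M| + 1, by positivity, ?_⟩
  refine hK.eventually_forall_of_forall_eventually fun μ hμ => ?_
  refine Eventually.and ?_ ?_
  · exact (hcont.continuousAt (x := (S, μ))).eventually (Units.isOpen.mem_nhds (h μ hμ))
  · have hlt : ‖Ring.inverse (1 + (μ - μ₀) • S)‖ < |M| + 1 :=
      ((hM μ hμ).trans (le_abs_self M)).trans_lt (lt_add_one _)
    exact ((hinv μ hμ).norm.eventually (Iio_mem_nhds hlt)).mono fun _ => le_of_lt

variable {E : Type*} [NormedAddCommGroup E] [NormedSpace ℂ E]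

/-- Factor `μ - (T + D) = (μ - T)(1 - R(μ, T) D)` and invert the second factor by a Neumann series.
The factor `2` comes from absorbing half of the norm in the resolvent identity, which is recorded
for the comparison with the limit operator. -/
theorem mem_resolventSet_add_of_norm_le [CompleteSpace E] {T D : E →L[ℂ] E} {μ : ℂ}
    (hμ : μ ∈ resolventSet ℂ T) (hD : ‖resolvent T μ * D‖ ≤ 1 / 2) :
    μ ∈ resolventSet ℂ (T + D) ∧ ‖resolvent (T + D) μ‖ ≤ 2 * ‖resolvent T μ‖ ∧
      resolvent (T + D) μ = resolvent T μ + resolvent T μ * D * resolvent (T + D) μ := by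
  have h1 : (algebraMap ℂ (E →L[ℂ] E) μ - T) * resolvent T μ = 1 := Ring.mul_inverse_cancel _ hμ
  have h1' : resolvent T μ * (algebraMap ℂ (E →L[ℂ] E) μ - T) = 1 := Ring.inverse_mul_cancel _ hμ
  have h2 : algebraMap ℂ (E →L[ℂ] E) μ - (T + D) =
      (algebraMap ℂ (E →L[ℂ] E) μ - T) * (1 - resolvent T μ * D) := by
    rw [mul_sub, mul_one, ← mul_assoc, h1, one_mul]; abel
  have hu : μ ∈ resolventSet ℂ (T + D) := by
    rw [spectrum.mem_resolventSet_iff, h2]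
    exact IsUnit.mul hμ (isUnit_one_sub_of_norm_lt_one (hD.trans_lt (by norm_num)))
  have h3 : (algebraMap ℂ (E →L[ℂ] E) μ - (T + D)) * resolvent (T + D) μ = 1 :=
    Ring.mul_inverse_cancel _ hu
  have h4 : resolvent (T + D) μ = resolvent T μ + resolvent T μ * D * resolvent (T + D) μ := by
    have := congrArg (fun S => resolvent T μ * S) h3
    simp only [h2] at this
    rw [mul_one, mul_assoc, ← mul_assoc (resolvent T μ), h1', one_mul, sub_mul, one_mul] at this
    exact sub_eq_iff_eq_add.1 this
  refine ⟨hu, ?_, h4⟩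
  have h5 : ‖resolvent (T + D) μ‖ ≤ ‖resolvent T μ‖ + 1 / 2 * ‖resolvent (T + D) μ‖ := by
    conv_lhs => rw [h4]
    refine (norm_add_le _ _).trans ?_
    gcongr
    exact (norm_mul_le _ _).trans (by gcongr)
  linarith

variable {H : Type*} [NormedAddCommGroup H] [NormedSpace ℂ H]

/-- If `P ι = 1` and `1 + (μ - μ₀) ι R(μ₀, T) P` is invertible then `μ ∈ ρ(T)`. -/
theorem mem_resolventSet_of_isUnit_one_add {T : E →L[ℂ] E} {μ₀ μ : ℂ}
    (hμ₀ : μ₀ ∈ resolventSet ℂ T) (ι : E →L[ℂ] H) (P : H →L[ℂ] E)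
    (hP : P.comp ι = 1) (hP1 : ‖P‖ ≤ 1) (hι1 : ‖ι‖ ≤ 1)
    (hu : IsUnit (1 + (μ - μ₀) • ι.comp ((resolvent T μ₀).comp P))) :
    μ ∈ resolventSet ℂ T ∧ ‖resolvent T μ‖ ≤
      ‖Ring.inverse (1 + (μ - μ₀) • ι.comp ((resolvent T μ₀).comp P))‖ * ‖resolvent T μ₀‖ := by
  set R := resolvent T μ₀ with hR
  set V : H →L[ℂ] H := 1 + (μ - μ₀) • ι.comp (R.comp P) with hV
  set N := Ring.inverse V
  have hPι : ∀ x, P (ι x) = x := fun x => congrArg (fun S : E →L[ℂ] E => S x) hP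
  have hNV : ∀ x, N (V x) = x := fun x =>
    congrArg (fun S : H →L[ℂ] H => S x) (Ring.inverse_mul_cancel V hu)
  have hVN : ∀ x, V (N x) = x := fun x =>
    congrArg (fun S : H →L[ℂ] H => S x) (Ring.mul_inverse_cancel V hu)
  -- `W` is the operator `V` seen on `E`. The relations `V ι = ι W` and `P V = W P` make the
  -- compression `P V⁻¹ ι` a two-sided inverse of `W`, and `μ - T = (μ₀ - T) W`.
  let W : E →L[ℂ] E := 1 + (μ - μ₀) • R
  let W' : E →L[ℂ] E := P.comp (N.comp ι)
  have hVι : ∀ x, V (ι x) = ι (W x) := fun x => by simp [hV, W, hPι]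
  have hPV : ∀ x, P (V x) = W (P x) := fun x => by simp [hV, W, hPι]
  have hW1 : W * W' = 1 := by
    ext x
    change W (P (N (ι x))) = x
    rw [← hPV, hVN, hPι]
  have hW2 : W' * W = 1 := by
    ext x
    change P (N (ι (W x))) = x
    rw [← hVι, hNV, hPι]
  have h1 : (algebraMap ℂ (E →L[ℂ] E) μ₀ - T) * R = 1 := Ring.mul_inverse_cancel _ hμ₀
  have h1' : R * (algebraMap ℂ (E →L[ℂ] E) μ₀ - T) = 1 := Ring.inverse_mul_cancel _ hμ₀
  have h2 : algebraMap ℂ (E →L[ℂ] E) μ - T = (algebraMap ℂ (E →L[ℂ] E) μ₀ - T) * W := by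
    rw [mul_add, mul_one, mul_smul_comm, h1, Algebra.algebraMap_eq_smul_one,
      Algebra.algebraMap_eq_smul_one]
    module
  have hres : resolvent T μ = W' * R := by
    have : (algebraMap ℂ (E →L[ℂ] E) μ - T) * (W' * R) = 1 := by
      rw [h2, mul_assoc, ← mul_assoc W, hW1, one_mul, h1]
    have h' : (W' * R) * (algebraMap ℂ (E →L[ℂ] E) μ - T) = 1 := by
      rw [h2, mul_assoc, ← mul_assoc R, h1', one_mul, hW2]
    exact Ring.inverse_unit (⟨_, _, this, h'⟩ : (E →L[ℂ] E)ˣ)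
  refine ⟨?_, ?_⟩
  · rw [spectrum.mem_resolventSet_iff, h2]
    exact IsUnit.mul hμ₀ ⟨⟨W, W', hW1, hW2⟩, rfl⟩
  · rw [hres]
    refine (norm_mul_le _ _).trans ?_
    gcongr
    calc ‖W'‖ ≤ ‖P‖ * (‖N‖ * ‖ι‖) :=
          (ContinuousLinearMap.opNorm_comp_le _ _).trans
            (by gcongr; exact ContinuousLinearMap.opNorm_comp_le _ _)
      _ ≤ 1 * (‖N‖ * 1) := by gcongr
      _ = ‖N‖ := by ring

end Perturbation

/-! ### Uniform estimates for the discrete closed loop -/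

section ExponentialStability

variable {H U : Type*} [NormedAddCommGroup H] [InnerProductSpace ℂ H]
  [NormedAddCommGroup U] [InnerProductSpace ℂ U]

theorem Pih_comp_subtypeL (Hh : ℝ → Submodule ℂ H) [∀ h, FiniteDimensional ℂ (Hh h)] (h : ℝ) :
    (Pih Hh h).comp (Hh h).subtypeL = 1 := by
  ext x
  simp [Pih]

theorem norm_Pih_le (Hh : ℝ → Submodule ℂ H) [∀ h, FiniteDimensional ℂ (Hh h)] (h : ℝ) :
    ‖Pih Hh h‖ ≤ 1 :=
  Submodule.orthogonalProjectionOnto_norm_le _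

/-- Difference of the closed loop resolvents `S = R + R B F S` and `ρ = R_h + R_h P B F_h ρ` in
terms of the differences of the open loop resolvents and of the feedbacks. -/
theorem norm_closedLoop_resolvent_sub_le {V : Submodule ℂ H} {R S : H →L[ℂ] H} {B : U →L[ℂ] H}
    {F : H →L[ℂ] U} {Rh ρ : V →L[ℂ] V} {Fh : V →L[ℂ] U} {P : H →L[ℂ] V} (hP : ‖P‖ ≤ 1)
    (hS : S = R + R * B.comp F * S) (hρ : ρ = Rh + Rh * (P.comp B).comp Fh * ρ)
    (hsmall : ‖R * B.comp F‖ ≤ 1 / 2) :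
    ‖S - V.subtypeL.comp (ρ.comp P)‖ ≤
      2 * (‖R - V.subtypeL.comp (Rh.comp P)‖ * (1 + ‖B‖ * ‖F‖ * ‖ρ‖) +
        ‖Rh‖ * ‖B‖ * ‖ρ‖ * ‖F.comp V.subtypeL - Fh‖) := by
  have hι : ‖V.subtypeL‖ ≤ 1 := V.norm_subtypeL_le
  set X := R - V.subtypeL.comp (Rh.comp P) with hX
  set Δ := S - V.subtypeL.comp (ρ.comp P) with hΔ
  set Y := F.comp V.subtypeL - Fh with hY
  -- Subtract the two identities and insert the mixed terms with `ι ρ P` and `ι R_h P`. The term `R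
  -- B F Δ` is at most `‖Δ‖/2` and is absorbed, hence the factor `2`.
  have key : Δ = X + (R * B.comp F) * Δ + (X.comp (B.comp (F.comp (V.subtypeL.comp (ρ.comp P)))) +
      V.subtypeL.comp (Rh.comp (P.comp (B.comp (Y.comp (ρ.comp P)))))) := by
    ext x
    have h1 := congrArg (fun T : H →L[ℂ] H => T x) hS
    have h2 := congrArg (fun T : V →L[ℂ] V => (T (P x) : H)) hρ
    simp only [add_apply, mul_apply_eq_comp, ContinuousLinearMap.comp_apply,
      Submodule.coe_add] at h1 h2
    simp only [hX, hΔ, hY, add_apply, sub_apply, mul_apply_eq_comp,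
      ContinuousLinearMap.comp_apply, Submodule.subtypeL_apply, map_sub]
    nth_rewrite 1 [h1]
    nth_rewrite 1 [h2]
    abel
  have h1 : ‖(R * B.comp F) * Δ‖ ≤ 1 / 2 * ‖Δ‖ :=
    (norm_mul_le _ _).trans (by gcongr)
  have hρP : ‖ρ.comp P‖ ≤ ‖ρ‖ * 1 :=
    (ContinuousLinearMap.opNorm_comp_le _ _).trans (by gcongr)
  have h2 : ‖X.comp (B.comp (F.comp (V.subtypeL.comp (ρ.comp P))))‖ ≤
      ‖X‖ * (‖B‖ * (‖F‖ * (1 * (‖ρ‖ * 1)))) := by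
    refine (ContinuousLinearMap.opNorm_comp_le _ _).trans ?_
    gcongr
    refine (ContinuousLinearMap.opNorm_comp_le _ _).trans ?_
    gcongr
    refine (ContinuousLinearMap.opNorm_comp_le _ _).trans ?_
    gcongr
    exact (ContinuousLinearMap.opNorm_comp_le _ _).trans (by gcongr)
  have h3 : ‖V.subtypeL.comp (Rh.comp (P.comp (B.comp (Y.comp (ρ.comp P)))))‖ ≤
      1 * (‖Rh‖ * (1 * (‖B‖ * (‖Y‖ * (‖ρ‖ * 1))))) := by
    refine (ContinuousLinearMap.opNorm_comp_le _ _).trans ?_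
    gcongr
    refine (ContinuousLinearMap.opNorm_comp_le _ _).trans ?_
    gcongr
    refine (ContinuousLinearMap.opNorm_comp_le _ _).trans ?_
    gcongr
    refine (ContinuousLinearMap.opNorm_comp_le _ _).trans ?_
    gcongr
    exact (ContinuousLinearMap.opNorm_comp_le _ _).trans (by gcongr)
  have h4 : ‖Δ‖ ≤ ‖X‖ + ‖(R * B.comp F) * Δ‖ +
      (‖X.comp (B.comp (F.comp (V.subtypeL.comp (ρ.comp P))))‖ +
      ‖V.subtypeL.comp (Rh.comp (P.comp (B.comp (Y.comp (ρ.comp P)))))‖) := by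
    conv_lhs => rw [key]
    exact (norm_add_le _ _).trans (add_le_add (norm_add_le _ _) (norm_add_le _ _))
  nlinarith

variable {A : H →ₗ.[ℂ] H} {B : U →L[ℂ] H} {Hh : ℝ → Submodule ℂ H}
  [∀ h, FiniteDimensional ℂ (Hh h)] {Ah : ∀ h, Hh h →L[ℂ] Hh h}
  {F : H →L[ℂ] U} {Fh : ∀ h, Hh h →L[ℂ] U} {νhat ω θ₀ θP γ φ₀ : ℝ}

/-- Far from the apex, the closed loop operators satisfy a uniform resolvent estimate, and at a
remote real point their resolvents converge in norm. -/
theorem exists_closedLoop_resolvent_bound (hθ₀ : Real.pi / 2 < θ₀) (hθ₀π : θ₀ < Real.pi)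
    (hA : SemigroupApproximation A B Hh Ah νhat ω θ₀) (hFh : UniformlyBoundedFeedback Fh)
    (hF : FeedbackConvergence F Fh) :
    ∃ C L : ℝ, 0 < C ∧ 0 < L ∧
      (∀ h, 0 < h → ∀ μ ∈ (sector (-νhat + ω) θ₀)ᶜ, L ≤ ‖μ - ((-νhat + ω : ℝ) : ℂ)‖ →
        μ ∈ resolventSet ℂ (discreteClosedLoop Ah ω B Fh h) ∧
        ‖resolvent (discreteClosedLoop Ah ω B Fh h) μ‖ ≤ C / ‖μ - ((-νhat + ω : ℝ) : ℂ)‖) ∧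
      ∀ x : ℝ, -νhat + ω + L ≤ x → ∀ S : H →L[ℂ] H,
        IsResolventAt (addBounded (shift A ω) (B.comp F)) x S →
        Tendsto (fun h => (Hh h).subtypeL.comp
          ((resolvent (discreteClosedLoop Ah ω B Fh h) (x : ℂ)).comp (Pih Hh h))) (𝓝[>] 0)
          (𝓝 S) := by
  obtain ⟨⟨CB, hCB, hB, hBh⟩, C₁, hC₁, ⟨-, hAρ, hAR⟩, hd, c₂, hc₂, hconv⟩ := hA
  obtain ⟨C₃, hC₃, hFh⟩ := hFh
  obtain ⟨s, c₄, hs, -, hc₄, hFc⟩ := hF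
  have hapex : ((-νhat + ω : ℝ) : ℂ) = -(νhat : ℂ) + ω := by push_cast; rfl
  have hsub : ∀ μ : ℂ, μ + νhat - ω = μ - ((-νhat + ω : ℝ) : ℂ) := fun μ => by rw [hapex]; ring
  simp only [hsub, ← hapex] at hAR hd
  set b : ℝ := -νhat + ω
  -- Beyond distance `L` the open loop resolvents are at most `C₁/L`, which makes the perturbations
  -- by `B_h F_h` and by `B F` both at most `1/2`.
  set L : ℝ := 2 * C₁ * CB * (C₃ + ‖F‖) with hL
  have hLpos : 0 < L := by positivity
  have hsmall : ∀ {r f : ℝ}, r ≤ C₁ / L → 0 ≤ f → f ≤ C₃ + ‖F‖ → r * (CB * f) ≤ 1 / 2 := by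
    intro r f hr hf0 hf
    calc r * (CB * f) ≤ C₁ / L * (CB * (C₃ + ‖F‖)) := by gcongr
      _ = 1 / 2 := by rw [hL]; field_simp
  have hne : ∀ {μ : ℂ}, L ≤ ‖μ - b‖ → μ ≠ b := by
    rintro μ hμ rfl
    rw [sub_self, norm_zero] at hμ
    exact hLpos.not_ge hμ
  have hbase : ∀ h : ℝ, 0 < h → ∀ μ ∈ (sector b θ₀)ᶜ, L ≤ ‖μ - b‖ →
      ‖resolvent (discreteShift Ah ω h) μ‖ ≤ C₁ / L := fun h hh μ hμ hμL =>
    ((hd h hh).2 μ hμ (hne hμL)).trans (by gcongr)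
  have hpert : ∀ h : ℝ, 0 < h → ∀ μ ∈ (sector b θ₀)ᶜ, L ≤ ‖μ - b‖ → _ := fun h hh μ hμ hμL =>
    mem_resolventSet_add_of_norm_le ((hd h hh).1 hμ)
      (D := (discreteControl Hh B h).comp (Fh h)) (by
        refine (norm_mul_le _ _).trans ((mul_le_mul_of_nonneg_left
          (ContinuousLinearMap.opNorm_comp_le _ _) (norm_nonneg _)).trans ?_)
        refine le_trans ?_ (hsmall (hbase h hh μ hμ hμL) hC₃.le
          (le_add_of_nonneg_right (norm_nonneg F)))
        gcongr
        exacts [hBh h hh, hFh h hh])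
  refine ⟨2 * C₁, L, by positivity, hLpos, fun h hh μ hμ hμL => ?_, fun x hx S hS => ?_⟩
  · refine ⟨(hpert h hh μ hμ hμL).1, (hpert h hh μ hμ hμL).2.1.trans ?_⟩
    rw [mul_div_assoc]
    gcongr
    exact (hd h hh).2 μ hμ (hne hμL)
  · have hxmem : (x : ℂ) ∈ (sector b θ₀)ᶜ :=
      ofReal_mem_compl_sector (by linarith [Real.pi_pos]) hθ₀π.le (by linarith)
    have hxL : L ≤ ‖(x : ℂ) - b‖ := by
      rw [← Complex.ofReal_sub, Complex.norm_real]
      exact le_trans (by linarith) (Real.le_norm_self _)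
    have hR := isResolventAt_resolventOp (hAρ hxmem)
    have hRn : ‖resolventOp (shift A ω) x‖ ≤ C₁ / L :=
      (hAR x hxmem (hne hxL)).trans (by gcongr)
    have hRBF : ‖resolventOp (shift A ω) x * B.comp F‖ ≤ 1 / 2 := by
      refine (norm_mul_le _ _).trans ((mul_le_mul_of_nonneg_left
        (ContinuousLinearMap.opNorm_comp_le _ _) (norm_nonneg _)).trans ?_)
      refine le_trans ?_ (hsmall hRn (norm_nonneg F) (le_add_of_nonneg_left hC₃.le))
      gcongr
    rw [tendsto_iff_norm_sub_tendsto_zero]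
    -- The majorant uses `C₁/L` for the discrete open loop resolvent and `2C₁/L` for the closed loop
    -- one; it vanishes as `h → 0` because `s > 0`.
    refine squeeze_zero' (g := fun h : ℝ => 2 * (c₂ * h ^ 2 * (1 + CB * ‖F‖ * (2 * (C₁ / L))) +
      C₁ / L * CB * (2 * (C₁ / L)) * (c₄ * h ^ s))) (Eventually.of_forall fun _ => norm_nonneg _)
      ?_ ?_
    · filter_upwards [self_mem_nhdsWithin] with h hh
      have hh : 0 < h := hh
      obtain ⟨-, h2, h3⟩ := hpert h hh x hxmem hxL
      have hRh := hbase h hh x hxmem hxL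
      have h4 := h2.trans (mul_le_mul_of_nonneg_left hRh zero_le_two)
      rw [norm_sub_rev]
      refine (norm_closedLoop_resolvent_sub_le (norm_Pih_le Hh h) (hR.eq_add_of_addBounded hS)
        h3 hRBF).trans ?_
      gcongr
      exacts [hconv h hh x hxmem, hFc h hh]
    · refine Tendsto.mono_left ?_ nhdsWithin_le_nhds
      have hc : Continuous fun h : ℝ => 2 * (c₂ * h ^ 2 * (1 + CB * ‖F‖ * (2 * (C₁ / L))) +
          C₁ / L * CB * (2 * (C₁ / L)) * (c₄ * h ^ s)) := by
        have := Real.continuous_rpow_const hs.le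
        fun_prop
      simpa [Real.zero_rpow hs.ne'] using hc.tendsto 0

/-- Uniform exponential stability of the discrete closed loop operators. -/
theorem uniformlyExpStable_discreteClosedLoop [CompleteSpace H]
    (hθ₀ : Real.pi / 2 < θ₀) (hθ₀π : θ₀ < Real.pi) (hθP : θP < Real.pi)
    (hφ₀ : Real.pi / 2 < φ₀) (hφ₀θ : φ₀ < min θ₀ θP)
    (hA : SemigroupApproximation A B Hh Ah νhat ω θ₀) (hFh : UniformlyBoundedFeedback Fh)
    (hF : FeedbackConvergence F Fh) (hP : StabilizingFeedback A ω B F γ θP) {g : ℝ} (hg : g < γ) :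
    UniformlyExpStable (discreteClosedLoop Ah ω B Fh) φ₀ g := by
  obtain ⟨C, L, hC, hL, hfar, hlim⟩ := exists_closedLoop_resolvent_bound hθ₀ hθ₀π hA hFh hF
  obtain ⟨-, -, hρ⟩ := hP
  set b : ℝ := -νhat + ω
  have hπ := Real.pi_pos
  have hφθ₀ : φ₀ < θ₀ := hφ₀θ.trans_le (min_le_left _ _)
  have hφθP : φ₀ < θP := hφ₀θ.trans_le (min_le_right _ _)
  have hφ0 : 0 ≤ φ₀ := by linarith
  have hcosφ : Real.cos φ₀ < 0 := Real.cos_neg_of_pi_div_two_lt_of_lt hφ₀ (by linarith)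
  have hcosθ : Real.cos θ₀ < 0 := Real.cos_neg_of_pi_div_two_lt_of_lt hθ₀ (by linarith)
  have hmem : ∀ z : ℂ, z ∈ (sector (-g) φ₀)ᶜ ↔
      z = ((-g : ℝ) : ℂ) ∨ Real.cos φ₀ * ‖z - ((-g : ℝ) : ℂ)‖ < (z - ((-g : ℝ) : ℂ)).re :=
    mem_compl_sector_iff hφ0 (by linarith)
  have hadd : ∀ z : ℂ, z + g = z - ((-g : ℝ) : ℂ) := fun z => by push_cast; ring
  have hapex : -(g : ℂ) = ((-g : ℝ) : ℂ) := by push_cast; rfl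
  -- Far enough right for the remote estimate, and also inside `ρ(A_{ω,F})`.
  set x : ℝ := max b (-γ) + L
  have hbx : b + L ≤ x := add_le_add (le_max_left _ _) le_rfl
  have hγx : -γ < x := (le_max_right b (-γ)).trans_lt (lt_add_of_pos_right _ hL)
  have hxsec : (x : ℂ) ∈ (sector b θ₀)ᶜ :=
    ofReal_mem_compl_sector (by linarith) hθ₀π.le (by linarith)
  have hxL : L ≤ ‖(x : ℂ) - b‖ := by
    rw [← Complex.ofReal_sub, Complex.norm_real]
    exact le_trans (by linarith) (Real.le_norm_self _)
  set S := resolventOp (addBounded (shift A ω) (B.comp F)) x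
  have hS : IsResolventAt (addBounded (shift A ω) (B.comp F)) x S :=
    isResolventAt_resolventOp (hρ (ofReal_mem_compl_sector (by linarith) hθP.le hγx))
  -- For `‖z + g‖ > r`, the first summand puts `z` off the sector at `b`; the other two ensure `‖z -
  -- b‖ ≥ L` and `‖z + g‖ ≤ 2 ‖z - b‖`.
  set r : ℝ := 2 * |-g - b| / (Real.cos φ₀ - Real.cos θ₀) + L + 2 * |-g - b| with hr
  have hq : 0 ≤ 2 * |-g - b| / (Real.cos φ₀ - Real.cos θ₀) :=
    div_nonneg (by positivity) (sub_nonneg.2 (Real.cos_lt_cos_of_nonneg_of_le_pi hφ0 hθ₀π.le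
      hφθ₀).le)
  have hr0 : 0 < r := by positivity
  -- The boundary rays are included for compactness; `g < γ` and `φ₀ < θP` keep them in
  -- `ρ(A_{ω,F})`.
  let K : Set ℂ := {z | Real.cos φ₀ * ‖z - ((-g : ℝ) : ℂ)‖ ≤ (z - ((-g : ℝ) : ℂ)).re} ∩
    Metric.closedBall ((-g : ℝ) : ℂ) r
  have hK : IsCompact K := by
    refine (isCompact_closedBall _ _).inter_left (isClosed_le ?_ ?_) <;> fun_prop
  obtain ⟨M, hM, hev⟩ := hK.eventually_isUnit_one_add_smul x S fun z hz =>
    hS.isUnit_one_add (isResolventAt_resolventOp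
      (hρ (mem_compl_sector_of_apex_lt (by linarith) hφ0 hφθP hθP.le hz.1 hcosφ.le)))
  obtain ⟨hg₀, hg₀pos, hsub⟩ := mem_nhdsGT_iff_exists_Ioo_subset.1
    ((hlim x hbx S hS).eventually hev)
  -- The first term serves `‖z + g‖ ≤ r`, where the resolvent is at most `M C/L`; the second serves
  -- the far region.
  set C₀ : ℝ := M * (C / L) * r + 2 * C with hC₀
  have hC₀pos : 0 < C₀ := by positivity
  have hres : ∀ h, 0 < h → h < hg₀ → ∀ z ∈ (sector (-g) φ₀)ᶜ,
      z ∈ resolventSet ℂ (discreteClosedLoop Ah ω B Fh h) ∧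
      (z ≠ ((-g : ℝ) : ℂ) → ‖resolvent (discreteClosedLoop Ah ω B Fh h) z‖ ≤ C₀ / ‖z + g‖) := by
    intro h hh hhg z hz
    rw [hadd]
    rcases le_or_gt ‖z - ((-g : ℝ) : ℂ)‖ r with hzr | hzr
    · have hzK : z ∈ K := by
        refine ⟨?_, mem_closedBall_iff_norm.2 hzr⟩
        rcases (hmem z).1 hz with rfl | h1
        · simp
        · exact h1.le
      obtain ⟨hu, hn⟩ := hsub ⟨hh, hhg⟩ z hzK
      obtain ⟨hx1, hx2⟩ := hfar h hh x hxsec hxL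
      obtain ⟨h1, h2⟩ := mem_resolventSet_of_isUnit_one_add hx1 (Hh h).subtypeL (Pih Hh h)
        (Pih_comp_subtypeL Hh h) (norm_Pih_le Hh h) (Submodule.norm_subtypeL_le _) hu
      refine ⟨h1, fun hne => ?_⟩
      rw [le_div_iff₀ (norm_pos_iff.2 (sub_ne_zero.2 hne))]
      have h3 : ‖resolvent (discreteClosedLoop Ah ω B Fh h) z‖ ≤ M * (C / L) :=
        h2.trans (mul_le_mul hn (hx2.trans (by gcongr)) (norm_nonneg _) hM.le)
      calc _ ≤ M * (C / L) * r := by gcongr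
        _ ≤ C₀ := by rw [hC₀]; linarith
    · have hpos : 0 < ‖z - ((-g : ℝ) : ℂ)‖ := hr0.trans hzr
      have hlt := ((hmem z).1 hz).resolve_left (sub_ne_zero.1 (norm_pos_iff.1 hpos))
      have habs := abs_nonneg (-g - b)
      have hzb : z ∈ (sector b θ₀)ᶜ :=
        mem_compl_sector_of_norm_ge hφ0 hφθ₀ hθ₀π.le hlt hcosθ.le (by linarith)
      have h1 : ‖z - ((-g : ℝ) : ℂ)‖ ≤ ‖z - b‖ + |-g - b| := by
        have := norm_sub_le (z - b) (((-g : ℝ) : ℂ) - b)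
        rwa [sub_sub_sub_cancel_right, ← Complex.ofReal_sub (-g) b, Complex.norm_real,
          Real.norm_eq_abs] at this
      obtain ⟨h2, h3⟩ := hfar h hh z hzb (by linarith)
      refine ⟨h2, fun _ => h3.trans ?_⟩
      rw [div_le_div_iff₀ (by linarith) hpos]
      have h4 : 0 ≤ M * (C / L) * r := by positivity
      nlinarith [norm_nonneg (z - b)]
  refine ⟨hg₀, C₀ + C₀ ^ 2 * Real.exp 1 / 2, hg₀pos, by positivity, fun h hh hhg =>
    ⟨⟨fun z hz => (hres h hh hhg z hz).1, fun z hz hne => ?_⟩, fun t ht => ?_⟩⟩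
  · refine ((hres h hh hhg z hz).2 (hapex ▸ hne)).trans ?_
    gcongr
    exact le_add_of_nonneg_right (by positivity)
  -- As `φ₀ > π/2`, the half plane needed for the decay estimate avoids the sector.
  · have hhalf : ∀ z : ℂ, -g < z.re → z ∈ (sector (-g) φ₀)ᶜ := fun z hz => by
      refine (hmem z).2 (Or.inr ((mul_nonpos_of_nonpos_of_nonneg hcosφ.le
        (norm_nonneg _)).trans_lt ?_))
      simpa using by linarith
    have : CompleteSpace (Hh h) := FiniteDimensional.complete ℂ _
    refine (norm_exp_le_of_resolvent_le (discreteClosedLoop Ah ω B Fh h) g C₀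
      (fun z hz => (hres h hh hhg z (hhalf z hz)).1)
      (fun z hz => (hres h hh hhg z (hhalf z hz)).2 ?_) t ht).trans ?_
    · rintro rfl
      simp at hz
    · gcongr
      exact le_add_of_nonneg_left hC₀pos.le

end ExponentialStability

/-! ### The abstract theorem and the coupled parabolic system as an instance -/

theorem mainTheorem9 :
    (∀ (H U : Type*) [NormedAddCommGroup H] [InnerProductSpace ℂ H] [CompleteSpace H]
      [NormedAddCommGroup U] [InnerProductSpace ℂ U] [CompleteSpace U]
      (A : H →ₗ.[ℂ] H) (B : U →L[ℂ] H) (Hh : ℝ → Submodule ℂ H)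
      [∀ h, FiniteDimensional ℂ (Hh h)] (Ah : ∀ h, Hh h →L[ℂ] Hh h)
      (F : H →L[ℂ] U) (Fh : ∀ h, Hh h →L[ℂ] U) (νhat ω θ₀ θP γ φ₀ : ℝ),
      Real.pi / 2 < θ₀ → θ₀ < Real.pi → Real.pi / 2 < θP → θP < Real.pi → 0 < γ →
      Real.pi / 2 < φ₀ → φ₀ < min θ₀ θP →
      SemigroupApproximation A B Hh Ah νhat ω θ₀ → UniformlyBoundedFeedback Fh → FeedbackConvergence F Fh →
      StabilizingFeedback A ω B F γ θP →
      ∀ g : ℝ, 0 < g → g < γ → UniformlyExpStable (discreteClosedLoop Ah ω B Fh) φ₀ g) ∧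
    (∀ (n : ℕ) (Ω 𝒪 : TopologicalSpace.Opens (EuclideanSpace ℝ (Fin n))) (c : Coeffs)
      (V : ℝ → Submodule ℂ (L2 Ω)) [∀ h, FiniteDimensional ℂ (V h)] (hV : ∀ h, V h ≤ H10 Ω)
      (F : StateSpace Ω →L[ℂ] L2 Ω) (Fh : ∀ h, pairs Ω (V h) →L[ℂ] L2 Ω)
      (ω θ₀ θP γ φ₀ : ℝ), 0 < ω →
      Real.pi / 2 < θ₀ → θ₀ < Real.pi → Real.pi / 2 < θP → θP < Real.pi → 0 < γ →
      Real.pi / 2 < φ₀ → φ₀ < min θ₀ θP →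
      SemigroupApproximation (parabolicOp Ω c) (controlOp Ω 𝒪) (fun h => pairs Ω (V h))
        (fun h => discreteOp Ω c (V h) (hV h)) c.nuhat ω θ₀ →
      UniformlyBoundedFeedback Fh → FeedbackConvergence F Fh →
      StabilizingFeedback (parabolicOp Ω c) ω (controlOp Ω 𝒪) F γ θP →
      ∀ g : ℝ, 0 < g → g < γ → UniformlyExpStable
        (discreteClosedLoop (fun h => discreteOp Ω c (V h) (hV h)) ω (controlOp Ω 𝒪) Fh) φ₀ g) := by
  refine ⟨?_, ?_⟩
  · intro H U _ _ _ _ _ _ A B Hh _ Ah F Fh νhat ω θ₀ θP γ φ₀ h1 h2 _ h4 _ h6 h7 hA hFh hF hP g _ hg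
    exact uniformlyExpStable_discreteClosedLoop h1 h2 h4 h6 h7 hA hFh hF hP hg
  · intro n Ω 𝒪 c V _ hV F Fh ω θ₀ θP γ φ₀ _ h1 h2 _ h4 _ h6 h7 hA hFh hF hP g _ hg
    exact uniformlyExpStable_discreteClosedLoop h1 h2 h4 h6 h7 hA hFh hF hP hg
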